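/- Consider the plant $\dot z = Az + B\psi(Sz) + Nw$, $y = Cz+\eta$, with $z\in\mathbb R^{n_z}$, $y,\eta\in\mathbb R^{n_y}$, $w\in\mathbb R^{n_w}$, where $\psi:\mathbb R^{n_q}\to\mathbb R^{n_s}$ is Lipschitz with constant $\ell>0$ and $A,B,C,N,S$ are real matrices of matching sizes. The output $y$ is available only at times $t_1<t_2<\dots$ with $0\le t_1\le T_2$ and $T_1\le t_{k+1}-t_k\le T_2$, where $0<T_1\le T_2$. For gains $L\in\mathbb R^{n_z\times n_y}$, $H\in\mathbb R^{n_y\times n_y}$ consider the observer $$\dot{\hat z}=A\hat z+B\psi(S\hat z)+L\theta,\quad \dot\theta=H\theta\quad (t\ne t_k),\qquad \hat z(t_k^+)=\hat z(t_k),\quad \theta(t_k^+)=y(t_k)-C\hat z(t_k),$$ and the performance output $y_p=C_p(z-\hat z)$, with $C_p\in\mathbb R^{n_p\times n_z}$. Model the interconnection as a hybrid system with state $x=(z,\hat z,\theta,\tau)$ and input $u=(w,\eta)$, where $\tau$ is a timer: $\dot\tau=-1$ while $\tau\in[0,T_2]$, a measurement arrives when $\tau=0$, and then $\tau^+\in[T_1,T_2]$.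 Let $\mathcal A$ be the set of states with $z=\hat z$, $\theta=0$, $\tau\in[0,T_2]$. Write $\operatorname{He}(M)=M+M^{\mathsf T}$; matrix inequalities are between symmetric matrices, and $\bullet$ denotes a block determined by symmetry. Let $\lambda_t,\gamma>0$. Suppose that there are symmetric positive definite $P_1\in\mathbb R^{n_z\times n_z}$, $P_2\in\mathbb R^{n_y\times n_y}$, reals $\delta,\chi>0$, and matrices $X\in\mathbb R^{n_z\times n_z}$, $U,W\in\mathbb R^{n_y\times n_y}$, $J\in\mathbb R^{n_z\times n_y}$ such that, for $\tau=0$ and for $\tau=T_2$, $$\begin{pmatrix}\operatorname{He}(R_1)&R_2+\mathcal P_\tau&R_3&R_4\\ \bullet&\mathcal N_\tau+\operatorname{He}(R_5)&R_3&R_4\\ \bullet&\bullet&-\gamma^2I&0\\ \bullet&\bullet&\bullet&-\chi I\end{pmatrix}<0,$$ where $\mathcal P_\tau=\operatorname{diag}(P_1,e^{\delta\tau}P_2)$, $\mathcal N_\tau=\operatorname{diag}(2\lambda_tP_1+C_p^{\mathsf T}C_p+\chi\ell^2S^{\mathsf T}S,\ (2\lambda_t-\delta)e^{\delta\tau}P_2)$,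 $$R_1=\begin{pmatrix}-X&C^{\mathsf T}U\\0&-U\end{pmatrix},\quad R_2=\begin{pmatrix}-X+X^{\mathsf T}A-JC&J+C^{\mathsf T}U\\-WC&-U+W\end{pmatrix},\quad R_3=\begin{pmatrix}X^{\mathsf T}N\\0\end{pmatrix},\quad R_4=\begin{pmatrix}X^{\mathsf T}B\\0\end{pmatrix},\quad R_5=\begin{pmatrix}A^{\mathsf T}X-C^{\mathsf T}J^{\mathsf T}&-C^{\mathsf T}W^{\mathsf T}\\J^{\mathsf T}&W^{\mathsf T}\end{pmatrix}.$$ Then $X$ and $U$ are nonsingular, and the observer with $L=X^{-\mathsf T}J$ and $H=U^{-\mathsf T}W$ has the following properties. (P1) For $w\equiv0$, $\eta\equiv0$, the set $\mathcal A$ is globally exponentially stable with convergence rate $\lambda_t$: maximal solutions are complete, and for some $\kappa,\lambda>0$ every solution $\phi$ satisfies, at all its hybrid times $(t,j)$, $|\phi(t,j)|_{\mathcal A}\le\kappa e^{-\lambda(t+j)}|\phi(0,0)|_{\mathcal A}$ and $|\phi(t,j)|_{\mathcal A}\le\kappa e^{-\lambda_t t}|\phi(0,0)|_{\mathcal A}$.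 (P2) The system is exponentially input-to-state stable with respect to $\mathcal A$: maximal solutions (for inputs that are bounded on bounded hybrid time intervals) are complete, and for some $\kappa,\lambda>0$ and some $\rho$ of class $\mathcal K$ every solution with $\|u\|_\infty<\infty$ satisfies $|\phi(t,j)|_{\mathcal A}\le\max\{\kappa e^{-\lambda(t+j)}|\phi(0,0)|_{\mathcal A},\rho(\|u\|_\infty)\}$; in particular $z-\hat z$ is bounded when $w$ and $\eta$ are bounded. (P3) There is $\alpha>0$ such that every solution with $\eta\equiv0$ satisfies $\|y_p\|_2\le\alpha|\phi(0,0)|_{\mathcal A}+\gamma\|w\|_2$, where the $L_2$ norms are taken over the ordinary time in the domain of the solution. The restriction $\delta>2\lambda_t$ is not needed: there are a plant with $n_z,n_y\ge1$ and reals $T_2,\lambda_t,\gamma>0$ for which the above matrix inequalities are feasible with some $\delta<2\lambda_t$. -/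

import Mathlib

open MeasureTheory Set Filter
open scoped ENNReal NNReal Matrix

noncomputable section

namespace SporadicObserver

/-- `ℝⁿ` with its Euclidean norm. -/
abbrev E (n : ℕ) : Type := EuclideanSpace ℝ (Fin n)

/-! ### Hybrid time domains and hybrid signals

A hybrid signal is a function of `(t, j)`; only its values on its domain, a subset of
`ℝ × ℕ` carried along separately, are ever used. -/

/-- The interval `{t | (t, j) ∈ D}`. -/
def slice (D : Set (ℝ × ℕ)) (j : ℕ) : Set ℝ := {t | (t, j) ∈ D}

/-- A hybrid time domain: the union of an infinite sequence of intervals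
`[t_j, t_{j+1}] × {j}`, `0 = t_0 ≤ t_1 ≤ …`, or of a finite one, in which case the last interval
is `[t_J, T]` or `[t_J, T)` or `[t_J, ∞)`. -/
def IsHybridTimeDomain (D : Set (ℝ × ℕ)) : Prop :=
  ∃ t : ℕ → ℝ, t 0 = 0 ∧ Monotone t ∧
    ((∀ j, slice D j = Icc (t j) (t (j + 1))) ∨
      ∃ J : ℕ, (∀ j < J, slice D j = Icc (t j) (t (j + 1))) ∧ (∀ j, J < j → slice D j = ∅) ∧
        ((∃ T, t J ≤ T ∧ slice D J = Icc (t J) T) ∨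
          (∃ T, t J < T ∧ slice D J = Ico (t J) T) ∨
          slice D J = Ici (t J)))

/-- The hybrid times of `D` at which a jump occurs. -/
def jumpTimes (D : Set (ℝ × ℕ)) : Set (ℝ × ℕ) := {p | p ∈ D ∧ (p.1, p.2 + 1) ∈ D}

/-- The ordinary times occurring in `D`. -/
def ordinaryTimes (D : Set (ℝ × ℕ)) : Set ℝ := {t | ∃ j, (t, j) ∈ D}

/-- `j(t)`: the least `j` with `(t, j) ∈ D`. -/
def firstIndex (D : Set (ℝ × ℕ)) (t : ℝ) : ℕ := sInf {j | (t, j) ∈ D}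

section Signals

variable {U : Type*} [NormedAddCommGroup U]

/-- A hybrid input: on each interval, Lebesgue measurable and locally essentially bounded. -/
def IsHybridInput (D : Set (ℝ × ℕ)) (u : ℝ → ℕ → U) : Prop :=
  ∀ j, AEStronglyMeasurable (fun t => u t j) (volume.restrict (slice D j)) ∧
    ∀ a b, Icc a b ⊆ slice D j → ∃ M : ℝ, ∀ᵐ t ∂volume.restrict (Icc a b), ‖u t j‖ ≤ M

/-- A hybrid arc: on each interval, locally absolutely continuous. -/
def IsHybridArc (D : Set (ℝ × ℕ)) (φ : ℝ → ℕ → U) : Prop :=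
  ∀ j a b, a ≤ b → Icc a b ⊆ slice D j →
    AbsolutelyContinuousOnInterval (fun t => φ t j) a b

/-- The `T`-truncated `L∞` norm of a hybrid signal: the larger of the essential supremum outside
the jump times and the supremum over the jump times, both over hybrid times with `s + k ≤ T`. -/
def truncNorm (D : Set (ℝ × ℕ)) (u : ℝ → ℕ → U) (T : ℝ) : ℝ≥0∞ :=
  max (⨆ k : ℕ, essSup (fun s => ‖u s k‖ₑ)
      (volume.restrict {s | (s, k) ∈ D \ jumpTimes D ∧ s + k ≤ T}))
    (⨆ p ∈ {p : ℝ × ℕ | p ∈ jumpTimes D ∧ p.1 + p.2 ≤ T}, ‖u p.1 p.2‖ₑ)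

/-- The `L∞` norm of a hybrid signal, the limit of the (monotone) truncated norms. -/
def supNorm (D : Set (ℝ × ℕ)) (u : ℝ → ℕ → U) : ℝ≥0∞ := ⨆ T : ℝ, truncNorm D u T

/-- `(∫ |v(s, j(s))|² ds)^{1/2}` over the ordinary times of `D`, as an extended real. -/
def l2Norm (D : Set (ℝ × ℕ)) (v : ℝ → ℕ → U) : ℝ≥0∞ :=
  (∫⁻ s in ordinaryTimes D, ‖v s (firstIndex D s)‖ₑ ^ 2) ^ (1 / 2 : ℝ)

end Signals

/-! ### Hybrid systems with inputs -/

/-- `ẋ = f(x, w)` for `x ∈ C`, and `x⁺ ∈ G(x, η)` for `x ∈ D`. -/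
structure HybridSystem (X W V : Type*) where
  flowMap : X → W → X
  flowSet : Set X
  jumpMap : X → V → Set X
  jumpSet : Set X

section Solutions

variable {X W V : Type*} [NormedAddCommGroup X] [NormedSpace ℝ X]
  [NormedAddCommGroup W] [NormedAddCommGroup V]

/-- `(φ, u)`, with `u = (w, η)` and common domain `D`, is a solution pair of `H`. -/
structure IsSolutionPair (H : HybridSystem X W V) (D : Set (ℝ × ℕ)) (φ : ℝ → ℕ → X)
    (u : ℝ → ℕ → WithLp 2 (W × V)) : Prop where
  domain : IsHybridTimeDomain D
  input : IsHybridInput D u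
  arc : IsHybridArc D φ
  init : φ 0 0 ∈ closure H.flowSet ∪ H.jumpSet
  flow_mem : ∀ j, ∀ t ∈ interior (slice D j), φ t j ∈ H.flowSet
  flow_eq : ∀ j, ∀ᵐ t ∂volume.restrict (interior (slice D j)),
    HasDerivAt (fun s => φ s j) (H.flowMap (φ t j) (u t j).fst) t
  jump : ∀ p ∈ jumpTimes D, φ p.1 p.2 ∈ H.jumpSet ∧
    φ p.1 (p.2 + 1) ∈ H.jumpMap (φ p.1 p.2) (u p.1 p.2).snd

/-- The input vanishes identically on `D`. -/
def IsZeroInput {U : Type*} [NormedAddCommGroup U] (D : Set (ℝ × ℕ)) (u : ℝ → ℕ → U) : Prop :=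
  ∀ p ∈ D, u p.1 p.2 = 0

/-- The input is bounded on each bounded piece of `D` (so it does not blow up at a missing
right endpoint of a bounded domain). -/
def IsBoundedOnBounded {U : Type*} [NormedAddCommGroup U] (D : Set (ℝ × ℕ))
    (u : ℝ → ℕ → U) : Prop :=
  ∀ T, truncNorm D u T < ∞

/-- Every solution pair with input in the class `K` that has no proper extension with input in
`K` is complete, i.e. its domain is unbounded. -/
def MaximalAreComplete (H : HybridSystem X W V)
    (K : Set (ℝ × ℕ) → (ℝ → ℕ → WithLp 2 (W × V)) → Prop) : Prop :=
  ∀ D φ u, IsSolutionPair H D φ u → K D u →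
    (∀ D' φ' u', IsSolutionPair H D' φ' u' → K D' u' → D ⊆ D' →
      (∀ p ∈ D, φ' p.1 p.2 = φ p.1 p.2 ∧ u' p.1 p.2 = u p.1 p.2) → D' = D) →
    ∀ r : ℝ, ∃ p ∈ D, r ≤ p.1 + p.2

/-- Functions of class `𝒦`. -/
def IsClassK (ρ : ℝ → ℝ) : Prop :=
  ContinuousOn ρ (Ici 0) ∧ StrictMonoOn ρ (Ici 0) ∧ ρ 0 = 0

/-- With zero input, the closed set `𝒜` is globally exponentially stable, and the convergence
rate with respect to ordinary time is (at least) `rate`. -/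
def IsGloballyExpStable (H : HybridSystem X W V) (𝒜 : Set X) (rate : ℝ) : Prop :=
  MaximalAreComplete H IsZeroInput ∧
  ∃ κ > 0, ∃ lam > 0, ∀ D φ u, IsSolutionPair H D φ u → IsZeroInput D u → ∀ p ∈ D,
    Metric.infDist (φ p.1 p.2) 𝒜
      ≤ κ * Real.exp (-lam * (p.1 + p.2)) * Metric.infDist (φ 0 0) 𝒜 ∧
    Metric.infDist (φ p.1 p.2) 𝒜 ≤ κ * Real.exp (-rate * p.1) * Metric.infDist (φ 0 0) 𝒜

/-- Exponential input-to-state stability with respect to the closed set `𝒜`. -/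
def IsExpISS (H : HybridSystem X W V) (𝒜 : Set X) : Prop :=
  MaximalAreComplete H IsBoundedOnBounded ∧
  ∃ κ > 0, ∃ lam > 0, ∃ ρ, IsClassK ρ ∧ ∀ D φ u, IsSolutionPair H D φ u → supNorm D u < ∞ →
    ∀ p ∈ D, Metric.infDist (φ p.1 p.2) 𝒜 ≤
      max (κ * Real.exp (-lam * (p.1 + p.2)) * Metric.infDist (φ 0 0) 𝒜)
        (ρ (supNorm D u).toReal)

end Solutions

/-! ### The plant and the observer -/

/-- The data of the plant `ż = A z + B ψ(S z) + N w`, `y = C z + η`, of the performance output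
`y_p = C_p (z - ẑ)`, and of a Lipschitz constant `ℓ > 0` of `ψ`. -/
structure Plant (nz ny nw nq ns np : ℕ) where
  A : Matrix (Fin nz) (Fin nz) ℝ
  B : Matrix (Fin nz) (Fin ns) ℝ
  C : Matrix (Fin ny) (Fin nz) ℝ
  N : Matrix (Fin nz) (Fin nw) ℝ
  S : Matrix (Fin nq) (Fin nz) ℝ
  Cp : Matrix (Fin np) (Fin nz) ℝ
  ψ : E nq → E ns
  ℓ : ℝ
  ℓ_pos : 0 < ℓ
  lipschitz : ∀ v₁ v₂, ‖ψ v₁ - ψ v₂‖ ≤ ℓ * ‖v₁ - v₂‖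

/-- The action of a matrix on Euclidean vectors. -/
abbrev app {m n : ℕ} (M : Matrix (Fin m) (Fin n) ℝ) (v : E n) : E m := Matrix.toEuclideanLin M v

/-- The states `(z, ẑ, θ, τ)` of the plant, the observer and the sampling timer, with the
Euclidean norm. -/
abbrev State (nz ny : ℕ) : Type := WithLp 2 (E nz × WithLp 2 (E nz × WithLp 2 (E ny × ℝ)))

namespace State

variable {nz ny : ℕ}

def mk (z zhat : E nz) (θ : E ny) (τ : ℝ) : State nz ny :=
  WithLp.toLp 2 (z, WithLp.toLp 2 (zhat, WithLp.toLp 2 (θ, τ)))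

/-- The plant state. -/
def z (x : State nz ny) : E nz := x.fst

/-- The estimate of the plant state. -/
def zhat (x : State nz ny) : E nz := x.snd.fst

/-- The intersample injection variable of the observer. -/
def θ (x : State nz ny) : E ny := x.snd.snd.fst

/-- The time to the next measurement. -/
def τ (x : State nz ny) : ℝ := x.snd.snd.snd

/-- The estimation error. -/
def ε (x : State nz ny) : E nz := x.z - x.zhat

end State

section Observer

variable {nz ny nw nq ns np : ℕ}

/-- The plant interconnected with the observer with gains `L`, `H`. Between measurements
`ẑ' = A ẑ + B ψ(S ẑ) + L θ` and `θ' = H θ`; at a measurement `θ⁺ = y - C ẑ` with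
`y = C z + η`. The timer `τ` decreases at unit rate from a value in `[0, T₂]`; a measurement
arrives when it reaches `0`, and it is then reset to any value in `[T₁, T₂]`, so that the
measurement times are exactly the sequences with `0 ≤ t₁ ≤ T₂` and `T₁ ≤ t_{k+1} - t_k ≤ T₂`. -/
def closedLoop (pl : Plant nz ny nw nq ns np) (T₁ T₂ : ℝ)
    (L : Matrix (Fin nz) (Fin ny) ℝ) (H : Matrix (Fin ny) (Fin ny) ℝ) :
    HybridSystem (State nz ny) (E nw) (E ny) where
  flowMap x w := State.mk
    (app pl.A x.z + app pl.B (pl.ψ (app pl.S x.z)) + app pl.N w)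
    (app pl.A x.zhat + app pl.B (pl.ψ (app pl.S x.zhat)) + app L x.θ)
    (app H x.θ)
    (-1)
  flowSet := {x | x.τ ∈ Icc 0 T₂}
  jumpMap x η := {g | ∃ v ∈ Icc T₁ T₂,
    g = State.mk x.z x.zhat ((app pl.C x.z + η) - app pl.C x.zhat) v}
  jumpSet := {x | x.τ = 0}

/-- The states in which the plant state and its estimate coincide, `θ` vanishes, and the timer
is in its range. (Since `θ̃ = C (z - ẑ) - θ`, these are the states with `z - ẑ = 0`, `θ̃ = 0`.) -/
def target (nz ny : ℕ) (T₂ : ℝ) : Set (State nz ny) :=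
  {x | x.z = x.zhat ∧ x.θ = 0 ∧ x.τ ∈ Icc 0 T₂}

/-- The observer with gains `L`, `H` solves the estimation problem with prescribed convergence
rate `rate` and prescribed `L₂`-gain `γ`, for measurement times as bounded by `T₁`, `T₂`. -/
structure SolvesEstimationProblem (pl : Plant nz ny nw nq ns np) (T₁ T₂ rate γ : ℝ)
    (L : Matrix (Fin nz) (Fin ny) ℝ) (H : Matrix (Fin ny) (Fin ny) ℝ) : Prop where
  /-- Global exponential stability, with the prescribed rate, without disturbances. -/
  exp_stable : IsGloballyExpStable (closedLoop pl T₁ T₂ L H) (target nz ny T₂) rate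
  /-- Robustness to bounded disturbances: exponential input-to-state stability. -/
  exp_iss : IsExpISS (closedLoop pl T₁ T₂ L H) (target nz ny T₂)
  /-- The estimation error is bounded whenever the disturbances are bounded. -/
  error_bounded : ∀ D φ u, IsSolutionPair (closedLoop pl T₁ T₂ L H) D φ u → supNorm D u < ∞ →
    ∃ M : ℝ, ∀ p ∈ D, ‖(φ p.1 p.2).ε‖ ≤ M
  /-- `L₂`-external stability from `w` to `y_p`, with gain `γ`, when `η ≡ 0`. -/
  l2_stable : ∃ α > 0, ∀ D φ u, IsSolutionPair (closedLoop pl T₁ T₂ L H) D φ u →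
    IsZeroInput D (fun t j => (u t j).snd) →
    l2Norm D (fun t j => app pl.Cp (φ t j).ε) ≤
      ENNReal.ofReal (α * Metric.infDist (φ 0 0) (target nz ny T₂)) +
        ENNReal.ofReal γ * l2Norm D (fun t j => (u t j).fst)

/-! ### The matrix inequalities -/

/-- `He(M) = M + Mᵀ`. -/
def He {ι : Type*} (M : Matrix ι ι ℝ) : Matrix ι ι ℝ := M + Mᵀ

/-- Negative definiteness (including symmetry). -/
def NegDef {ι : Type*} (M : Matrix ι ι ℝ) : Prop := (-M).PosDef

/-- The symmetric matrix of one of the two inequalities, where `e` stands for `e^{δ τ}`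
(`τ = 0` in the first inequality, `τ = T₂` in the second one):
`[He R₁, R₂ + 𝒫, R₃, R₄; •, 𝒩 + He R₅, R₆, R₇; •, •, -γ² I, 0; •, •, •, -χ I]` with
`𝒫 = diag(P₁, e P₂)` and
`𝒩 = diag(2 λ P₁ + C_pᵀ C_p + χ ℓ² Sᵀ S, (2 λ - δ) e P₂)`. -/
def lmiMatrix (pl : Plant nz ny nw nq ns np) (lam γ δ χ e : ℝ)
    (P₁ : Matrix (Fin nz) (Fin nz) ℝ) (P₂ : Matrix (Fin ny) (Fin ny) ℝ)
    (X : Matrix (Fin nz) (Fin nz) ℝ) (U W : Matrix (Fin ny) (Fin ny) ℝ)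
    (J : Matrix (Fin nz) (Fin ny) ℝ) :
    Matrix (((Fin nz ⊕ Fin ny) ⊕ (Fin nz ⊕ Fin ny)) ⊕ (Fin nw ⊕ Fin ns))
      (((Fin nz ⊕ Fin ny) ⊕ (Fin nz ⊕ Fin ny)) ⊕ (Fin nw ⊕ Fin ns)) ℝ :=
  let Pdiag : Matrix (Fin nz ⊕ Fin ny) (Fin nz ⊕ Fin ny) ℝ := Matrix.fromBlocks P₁ 0 0 (e • P₂)
  let Ndiag : Matrix (Fin nz ⊕ Fin ny) (Fin nz ⊕ Fin ny) ℝ := Matrix.fromBlocks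
    ((2 * lam) • P₁ + pl.Cpᵀ * pl.Cp + (χ * pl.ℓ ^ 2) • (pl.Sᵀ * pl.S)) 0
    0 (((2 * lam - δ) * e) • P₂)
  let R₁ : Matrix (Fin nz ⊕ Fin ny) (Fin nz ⊕ Fin ny) ℝ := Matrix.fromBlocks
    (-X) (pl.Cᵀ * U)
    0 (-U)
  let R₂ : Matrix (Fin nz ⊕ Fin ny) (Fin nz ⊕ Fin ny) ℝ := Matrix.fromBlocks
    (-X + Xᵀ * pl.A - J * pl.C) (J + pl.Cᵀ * U)
    (-(W * pl.C)) (-U + W)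
  let R₃ : Matrix (Fin nz ⊕ Fin ny) (Fin nw) ℝ := Matrix.fromRows (Xᵀ * pl.N) 0
  let R₄ : Matrix (Fin nz ⊕ Fin ny) (Fin ns) ℝ := Matrix.fromRows (Xᵀ * pl.B) 0
  let R₅ : Matrix (Fin nz ⊕ Fin ny) (Fin nz ⊕ Fin ny) ℝ := Matrix.fromBlocks
    (pl.Aᵀ * X - pl.Cᵀ * Jᵀ) (-(pl.Cᵀ * Wᵀ))
    Jᵀ Wᵀ
  let R₆ : Matrix (Fin nz ⊕ Fin ny) (Fin nw) ℝ := Matrix.fromRows (Xᵀ * pl.N) 0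
  let R₇ : Matrix (Fin nz ⊕ Fin ny) (Fin ns) ℝ := Matrix.fromRows (Xᵀ * pl.B) 0
  Matrix.fromBlocks
    (Matrix.fromBlocks (He R₁) (R₂ + Pdiag) (R₂ + Pdiag)ᵀ (Ndiag + He R₅))
    (Matrix.fromBlocks R₃ R₄ R₆ R₇)
    (Matrix.fromBlocks R₃ R₄ R₆ R₇)ᵀ
    (Matrix.fromBlocks (-(γ ^ 2) • 1) 0 0 (-χ • 1))

/-- Both matrix inequalities hold, with `P₁`, `P₂` symmetric positive definite and `δ`, `χ`
positive. -/
structure LMIsFeasibleAt (pl : Plant nz ny nw nq ns np) (T₂ lam γ δ χ : ℝ)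
    (P₁ : Matrix (Fin nz) (Fin nz) ℝ) (P₂ : Matrix (Fin ny) (Fin ny) ℝ)
    (X : Matrix (Fin nz) (Fin nz) ℝ) (U W : Matrix (Fin ny) (Fin ny) ℝ)
    (J : Matrix (Fin nz) (Fin ny) ℝ) : Prop where
  P₁_pos : P₁.PosDef
  P₂_pos : P₂.PosDef
  δ_pos : 0 < δ
  χ_pos : 0 < χ
  lmi_zero : NegDef (lmiMatrix pl lam γ δ χ 1 P₁ P₂ X U W J)
  lmi_T₂ : NegDef (lmiMatrix pl lam γ δ χ (Real.exp (δ * T₂)) P₁ P₂ X U W J)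

end Observer

end SporadicObserver

end

/-!
The estimation error `ε = z - ẑ` and the output error `θ̃ = C ε - θ` form a linear flow driven by
`w` and by the Lipschitz increment `ζ = ψ (S z) - ψ (S ẑ)`, and `θ̃` is reset to `-η` at a
measurement. The Lyapunov function is `V = εᵀ P₁ ε + e^{δ τ} θ̃ᵀ P₂ θ̃`.

The matrix inequality is affine in `e^{δ τ}`, so its validity at `τ = 0` and `τ = T₂` gives it for
every `τ ∈ [0, T₂]`. Since `J = Xᵀ L` and `W = Uᵀ H`, evaluating it at `(ε', θ̃', ε, θ̃, w, ζ)`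
makes the terms with the multipliers `X` and `U` vanish, and the term with `χ` is absorbed by the
Lipschitz bound; what is left is `V' ≤ -2 λ V - |y_p|² + γ² |w|²`. A measurement increases `V` by
at most `e^{δ T₂} ηᵀ P₂ η`.

Consecutive measurements are at least `T₁` apart, so decay in `t` is decay in `t + j`, and the
jumps of `V` sum up to a convergent geometric series; this gives exponential stability and
input-to-state stability. Integrating the dissipation inequality gives the `L₂` gain. Maximal
solutions are complete because a solution on a bounded domain can be continued by a flow or a
jump.
-/

noncomputable section

open scoped Topology

namespace SporadicObserver

/-! ### Absolutely continuous functions -/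

section AbsolutelyContinuous

variable {F G : Type*} {a b c d : ℝ}

theorem absolutelyContinuousOnInterval_comp_lipschitzOnWith [PseudoMetricSpace F]
    [PseudoMetricSpace G] {f : ℝ → F} {q : F → G} {s : Set F} {K : ℝ≥0}
    (hq : LipschitzOnWith K q s) (hf : AbsolutelyContinuousOnInterval f a b)
    (hs : MapsTo f (uIcc a b) s) : AbsolutelyContinuousOnInterval (q ∘ f) a b := by
  unfold AbsolutelyContinuousOnInterval at hf ⊢
  refine squeeze_zero' (.of_forall fun _ => Finset.sum_nonneg fun _ _ => dist_nonneg) ?_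
    (by simpa using hf.const_mul (K : ℝ))
  rw [eventually_inf_principal]
  filter_upwards with I hI
  rw [Finset.mul_sum]
  exact Finset.sum_le_sum fun i hi => hq.dist_le_mul _ (hs (hI.1 i hi).1) _ (hs (hI.1 i hi).2)

theorem absolutelyContinuousOnInterval_comp_contDiff [NormedAddCommGroup F] [NormedSpace ℝ F]
    [FiniteDimensional ℝ F] [NormedAddCommGroup G] [NormedSpace ℝ G] {f : ℝ → F} {q : F → G}
    (hq : ContDiff ℝ 1 q) (hf : AbsolutelyContinuousOnInterval f a b) :
    AbsolutelyContinuousOnInterval (q ∘ f) a b := by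
  obtain ⟨M, hM⟩ := hf.exists_bound
  have := FiniteDimensional.proper_real F
  obtain ⟨K, hK⟩ := (hq.contDiffOn (s := Metric.closedBall (0 : F) M)).exists_lipschitzOnWith
    (by decide) (convex_closedBall _ _) (isCompact_closedBall _ _)
  exact absolutelyContinuousOnInterval_comp_lipschitzOnWith hK hf
    fun t ht => by simpa using hM t ht

theorem absolutelyContinuousOnInterval_comp_monotone [PseudoMetricSpace F] {f : ℝ → F} {p : ℝ → ℝ}
    (hf : AbsolutelyContinuousOnInterval f c d) (hp : Monotone p) (hp₁ : LipschitzWith 1 p)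
    (hs : MapsTo p (uIcc a b) (uIcc c d)) : AbsolutelyContinuousOnInterval (f ∘ p) a b := by
  rw [absolutelyContinuousOnInterval_iff] at hf ⊢
  intro ε hε
  obtain ⟨δ, hδ, h⟩ := hf ε hε
  refine ⟨δ, hδ, fun I hI hlen => ?_⟩
  refine h (I.1, fun i => (p (I.2 i).1, p (I.2 i).2))
    ⟨fun i hi => ⟨hs (hI.1 i hi).1, hs (hI.1 i hi).2⟩, fun i hi j hj hij => ?_⟩
    ((Finset.sum_le_sum fun i _ => ?_).trans_lt hlen)
  · have hdisj := hI.2 hi hj hij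
    simp only [Function.onFun, Set.uIoc, Set.Ioc_disjoint_Ioc] at hdisj ⊢
    simpa only [hp.map_min, hp.map_max] using hp hdisj
  · simpa using hp₁.dist_le_mul (I.2 i).1 (I.2 i).2

theorem absolutelyContinuousOnInterval_congr [PseudoMetricSpace F] {f g : ℝ → F}
    (hf : AbsolutelyContinuousOnInterval f a b) (h : EqOn f g (uIcc a b)) :
    AbsolutelyContinuousOnInterval g a b := by
  rw [absolutelyContinuousOnInterval_iff] at hf ⊢
  intro ε hε
  obtain ⟨δ, hδ, hf⟩ := hf ε hε
  refine ⟨δ, hδ, fun I hI hlen => ?_⟩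
  rw [Finset.sum_congr rfl fun i hi => by rw [← h (hI.1 i hi).1, ← h (hI.1 i hi).2]]
  exact hf I hI hlen

theorem absolutelyContinuousOnInterval_ite [NormedAddCommGroup F] {f g : ℝ → F}
    (hac : a ≤ c) (hcb : c ≤ b) (hf : AbsolutelyContinuousOnInterval f a c)
    (hg : AbsolutelyContinuousOnInterval g c b) (h : f c = g c) :
    AbsolutelyContinuousOnInterval (fun t => if t ≤ c then f t else g t) a b := by
  have hf' : AbsolutelyContinuousOnInterval (f ∘ fun t => min t c) a b :=
    absolutelyContinuousOnInterval_comp_monotone hf (fun _ _ h => min_le_min_right c h)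
      (by simpa using! LipschitzWith.id.min_const c) fun t ht => by
        rw [uIcc_of_le (hac.trans hcb)] at ht; rw [uIcc_of_le hac]; grind
  have hg' : AbsolutelyContinuousOnInterval (g ∘ fun t => max t c) a b :=
    absolutelyContinuousOnInterval_comp_monotone hg (fun _ _ h => max_le_max_right c h)
      (by simpa using! LipschitzWith.id.max_const c) fun t ht => by
        rw [uIcc_of_le (hac.trans hcb)] at ht; rw [uIcc_of_le hcb]; grind
  have hconst : AbsolutelyContinuousOnInterval (fun _ => g c) a b :=
    (LipschitzWith.const (g c)).lipschitzOnWith.absolutelyContinuousOnInterval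
  refine absolutelyContinuousOnInterval_congr ((hf'.add hg').sub hconst) fun t _ => ?_
  by_cases ht : t ≤ c
  · simp [ht]
  · simp [ht, (not_le.1 ht).le, h]

theorem sub_le_integral_of_ae_hasDerivAt {g g' h : ℝ → ℝ} (hab : a ≤ b)
    (hg : AbsolutelyContinuousOnInterval g a b)
    (hd : ∀ᵐ t, t ∈ Ioo a b → HasDerivAt g (g' t) t ∧ g' t ≤ h t)
    (hh : IntegrableOn h (Ioc a b)) : g b - g a ≤ ∫ t in Ioc a b, h t := by
  rw [← hg.integral_deriv_eq_sub, intervalIntegral.integral_of_le hab,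
    integral_Ioc_eq_integral_Ioo, integral_Ioc_eq_integral_Ioo]
  have hint := (intervalIntegrable_iff_integrableOn_Ioc_of_le hab).1 hg.intervalIntegrable_deriv
  refine integral_mono_ae (hint.mono_set Ioo_subset_Ioc_self) (hh.mono_set Ioo_subset_Ioc_self) ?_
  rw [EventuallyLE, ae_restrict_iff' measurableSet_Ioo]
  filter_upwards [hd] with t ht hm
  exact (ht hm).1.deriv ▸ (ht hm).2

theorem eq_add_mul_of_ae_hasDerivAt {g : ℝ → ℝ} (hab : a ≤ b)
    (hg : AbsolutelyContinuousOnInterval g a b)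
    (hd : ∀ᵐ t, t ∈ Ioo a b → HasDerivAt g c t) : g b = g a + c * (b - a) := by
  have hle := sub_le_integral_of_ae_hasDerivAt (h := fun _ => c) (g' := fun _ => c) hab hg
    (hd.mono fun t ht hm => ⟨ht hm, le_rfl⟩) (integrableOn_const measure_Ioc_lt_top.ne)
  have hge := sub_le_integral_of_ae_hasDerivAt (h := fun _ => -c) (g' := fun _ => -c) hab hg.neg
    (hd.mono fun t ht hm => ⟨(ht hm).neg, le_rfl⟩) (integrableOn_const measure_Ioc_lt_top.ne)
  simp only [Pi.neg_apply, setIntegral_const, Real.volume_real_Ioc_of_le hab, smul_eq_mul]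
    at hle hge
  linarith

theorem le_exp_mul_of_ae_deriv_le_mul {v v' : ℝ → ℝ} {K : ℝ} (hab : a ≤ b)
    (hv : AbsolutelyContinuousOnInterval v a b)
    (hd : ∀ᵐ t, t ∈ Ioo a b → HasDerivAt v (v' t) t ∧ v' t ≤ K * v t) :
    v b ≤ Real.exp (K * (b - a)) * v a := by
  have hexp : AbsolutelyContinuousOnInterval (fun t => Real.exp (-K * (t - a))) a b :=
    (ContDiff.contDiffOn (by fun_prop)).absolutelyContinuousOnInterval
  have hdecr := sub_le_integral_of_ae_hasDerivAt (h := 0) (g' := fun t =>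
    -K * Real.exp (-K * (t - a)) * v t + Real.exp (-K * (t - a)) * v' t) hab (hexp.mul hv) ?_
    integrableOn_zero
  · simp only [Pi.mul_apply, sub_self, mul_zero, Real.exp_zero, Pi.zero_apply,
      integral_zero, tsub_le_iff_right, zero_add, neg_mul, Real.exp_neg, inv_one, one_mul] at hdecr
    exact (inv_mul_le_iff₀ (Real.exp_pos _)).1 hdecr
  · filter_upwards [hd] with t ht hm
    obtain ⟨hder, hle⟩ := ht hm
    have hexp' : HasDerivAt (fun t => Real.exp (-K * (t - a)))
        (-K * Real.exp (-K * (t - a))) t := by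
      simpa [mul_comm] using (((hasDerivAt_id t).sub_const a).const_mul (-K)).exp
    refine ⟨hexp'.mul hder, ?_⟩
    have := mul_le_mul_of_nonneg_left hle (Real.exp_pos (-K * (t - a))).le
    simp only [Pi.zero_apply]
    linarith

variable [NormedAddCommGroup F] [InnerProductSpace ℝ F]

theorem norm_sub_le_of_ae_norm_deriv_le {f f' : ℝ → F} {M : ℝ≥0} (hab : a ≤ b)
    (hf : AbsolutelyContinuousOnInterval f a b)
    (hd : ∀ᵐ t, t ∈ Ioo a b → HasDerivAt f (f' t) t ∧ ‖f' t‖ ≤ M) :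
    ‖f b - f a‖ ≤ M * (b - a) := by
  set e := f b - f a with he
  have hinner : AbsolutelyContinuousOnInterval (innerSL ℝ e ∘ f) a b :=
    absolutelyContinuousOnInterval_comp_lipschitzOnWith (s := univ)
      (innerSL ℝ e).lipschitz.lipschitzOnWith hf (mapsTo_univ _ _)
  have hle := sub_le_integral_of_ae_hasDerivAt (g' := fun t => inner ℝ e (f' t))
    (h := fun _ => ‖e‖ * M) hab hinner ?_ (integrableOn_const measure_Ioc_lt_top.ne)
  · have hsq : ‖e‖ ^ 2 ≤ (b - a) * (‖e‖ * M) := by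
      simpa [← inner_sub_right, ← he, Real.volume_real_Ioc_of_le hab] using hle
    rcases (norm_nonneg e).eq_or_lt with h0 | h0
    · rw [← h0]
      exact mul_nonneg M.2 (sub_nonneg.2 hab)
    · exact le_of_mul_le_mul_left (by linarith) h0
  · filter_upwards [hd] with t ht hm
    refine ⟨(innerSL ℝ e).hasFDerivAt.comp_hasDerivAt t (ht hm).1, ?_⟩
    exact (real_inner_le_norm _ _).trans (mul_le_mul_of_nonneg_left (ht hm).2 (norm_nonneg _))

theorem norm_sq_add_one_le_of_ae_norm_deriv_le [FiniteDimensional ℝ F] {f f' : ℝ → F} {k : ℝ}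
    (hk : 0 ≤ k) (hab : a ≤ b) (hf : AbsolutelyContinuousOnInterval f a b)
    (hd : ∀ᵐ t, t ∈ Ioo a b → HasDerivAt f (f' t) t ∧ ‖f' t‖ ≤ k * (‖f t‖ + 1)) :
    ‖f b‖ ^ 2 + 1 ≤ Real.exp (4 * k * (b - a)) * (‖f a‖ ^ 2 + 1) := by
  refine le_exp_mul_of_ae_deriv_le_mul (v := (fun x => ‖x‖ ^ 2 + 1) ∘ f)
    (v' := fun t => 2 * inner ℝ (f t) (f' t)) hab
    (absolutelyContinuousOnInterval_comp_contDiff ((contDiff_norm_sq ℝ).add contDiff_const) hf) ?_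
  filter_upwards [hd] with t ht hm
  obtain ⟨hder, hle⟩ := ht hm
  refine ⟨hder.norm_sq.add_const 1, ?_⟩
  have hinner : inner ℝ (f t) (f' t) ≤ ‖f t‖ * (k * (‖f t‖ + 1)) :=
    (real_inner_le_norm _ _).trans (mul_le_mul_of_nonneg_left hle (norm_nonneg _))
  have hsq : 0 ≤ k * (2 * ‖f t‖ ^ 2 - 2 * ‖f t‖ + 4) :=
    mul_nonneg hk (by nlinarith [sq_nonneg (‖f t‖ - 1)])
  simp only [Function.comp_apply]
  linarith

theorem exists_lipschitzOnWith_Ico_of_ae_norm_deriv_le [FiniteDimensional ℝ F] {f f' : ℝ → F}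
    {k : ℝ} (hk : 0 ≤ k) (hf : ∀ t ∈ Ico a b, AbsolutelyContinuousOnInterval f a t)
    (hd : ∀ᵐ t, t ∈ Ioo a b → HasDerivAt f (f' t) t ∧ ‖f' t‖ ≤ k * (‖f t‖ + 1)) :
    ∃ K, LipschitzOnWith K f (Ico a b) := by
  set R := Real.exp (4 * k * (b - a)) * (‖f a‖ ^ 2 + 1)
  have hR : ∀ t ∈ Ico a b, ‖f t‖ ≤ R := by
    intro t ht
    have hgrowth := norm_sq_add_one_le_of_ae_norm_deriv_le hk ht.1 (hf t ht)
      (hd.mono fun s hs hst => hs ⟨hst.1, hst.2.trans ht.2⟩)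
    have hexp : Real.exp (4 * k * (t - a)) * (‖f a‖ ^ 2 + 1) ≤ R := by
      refine mul_le_mul_of_nonneg_right (Real.exp_le_exp.2 (mul_le_mul_of_nonneg_left ?_ ?_)) ?_
      exacts [sub_le_sub_right ht.2.le a, by positivity, by positivity]
    nlinarith [sq_nonneg (‖f t‖ - 1)]
  lift k * (R + 1) to ℝ≥0 using by positivity with K hK
  have hdist : ∀ s t, a ≤ s → s ≤ t → t < b → ‖f t - f s‖ ≤ K * (t - s) := by
    intro s t has hst htb
    refine norm_sub_le_of_ae_norm_deriv_le (f' := f') hst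
      ((hf t ⟨has.trans hst, htb⟩).mono ?_) ?_
    · rw [uIcc_of_le hst, uIcc_of_le (has.trans hst)]
      exact Icc_subset_Icc_left has
    · filter_upwards [hd] with r hr hrst
      have hr' : r ∈ Ioo a b := ⟨has.trans_lt hrst.1, hrst.2.trans htb⟩
      refine ⟨(hr hr').1, (hr hr').2.trans (hK ▸ ?_)⟩
      have := hR r (Ioo_subset_Ico_self hr')
      gcongr
  refine ⟨K, LipschitzOnWith.of_dist_le_mul fun s hs t ht => ?_⟩
  wlog hst : s ≤ t generalizing s t
  · rw [dist_comm, dist_comm s]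
    exact this t ht s hs (le_of_not_ge hst)
  rw [dist_comm, dist_eq_norm, dist_comm, Real.dist_eq, abs_of_nonneg (sub_nonneg.2 hst)]
  exact hdist s t hs.1 hst ht.2

end AbsolutelyContinuous

/-! ### Hybrid time domains -/

section Domain

variable {D : Set (ℝ × ℕ)}

@[simp] theorem mem_slice {t : ℝ} {j : ℕ} : t ∈ slice D j ↔ (t, j) ∈ D := Iff.rfl

/-- `t` lists the starting times of the intervals of the hybrid time domain `D`; its values beyond
the last interval are arbitrary. -/
structure HasStartTimes (D : Set (ℝ × ℕ)) (t : ℕ → ℝ) : Prop where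
  zero : t 0 = 0
  mono : Monotone t
  le_of_mem : ∀ {j s}, (s, j) ∈ D → t j ≤ s
  Icc_subset : ∀ {j s}, (s, j) ∈ D → Icc (t j) s ⊆ slice D j
  slice_eq : ∀ {i j s}, i < j → (s, j) ∈ D → slice D i = Icc (t i) (t (i + 1))
  zero_mem : (0, 0) ∈ D

theorem HasStartTimes.start_mem {t : ℕ → ℝ} (ht : HasStartTimes D t) {s : ℝ} {j : ℕ}
    (hs : (s, j) ∈ D) : (t j, j) ∈ D :=
  ht.Icc_subset hs (left_mem_Icc.2 (ht.le_of_mem hs))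

theorem IsHybridTimeDomain.exists_hasStartTimes (hD : IsHybridTimeDomain D) :
    ∃ t, HasStartTimes D t := by
  obtain ⟨t, zero, mono, h⟩ := hD
  have shape : ∀ j, slice D j = ∅ ∨ (∃ T, slice D j = Icc (t j) T) ∨
      (∃ T, slice D j = Ico (t j) T) ∨ slice D j = Ici (t j) := by
    intro j
    rcases h with h | ⟨J, hlt, hgt, hJ⟩
    · exact .inr (.inl ⟨_, h j⟩)
    rcases lt_trichotomy j J with hj | rfl | hj
    · exact .inr (.inl ⟨_, hlt j hj⟩)
    · rcases hJ with ⟨T, -, hJ⟩ | ⟨T, -, hJ⟩ | hJ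
      exacts [.inr (.inl ⟨T, hJ⟩), .inr (.inr (.inl ⟨T, hJ⟩)), .inr (.inr (.inr hJ))]
    · exact .inl (hgt j hj)
  have nonempty : (slice D 0).Nonempty := by
    rcases h with h | ⟨J, hlt, -, hJ⟩
    · exact h 0 ▸ nonempty_Icc.2 (mono zero_le_one)
    rcases J.eq_zero_or_pos with rfl | hpos
    · rcases hJ with ⟨T, hT, hJ⟩ | ⟨T, hT, hJ⟩ | hJ <;> rw [hJ]
      exacts [nonempty_Icc.2 hT, nonempty_Ico.2 hT, nonempty_Ici]
    · exact hlt 0 hpos ▸ nonempty_Icc.2 (mono zero_le_one)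
  have mem : ∀ {j s}, (s, j) ∈ D → t j ≤ s ∧ Icc (t j) s ⊆ slice D j := by
    intro j s hs
    rw [← mem_slice] at hs
    rcases shape j with hj | ⟨T, hj⟩ | ⟨T, hj⟩ | hj <;> rw [hj] at hs ⊢
    exacts [hs.elim, ⟨hs.1, Icc_subset_Icc_right hs.2⟩, ⟨hs.1, Icc_subset_Ico_right hs.2⟩,
      ⟨hs, Icc_subset_Ici_self⟩]
  refine ⟨t, zero, mono, fun hs => (mem hs).1, fun hs => (mem hs).2, fun {i j s} hij hs => ?_, ?_⟩
  · rcases h with h | ⟨J, hlt, hgt, -⟩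
    · exact h i
    · refine hlt i (hij.trans_le (not_lt.1 fun hj => ?_))
      exact (hgt j hj ▸ mem_slice.2 hs : s ∈ (∅ : Set ℝ))
  · obtain ⟨s, hs⟩ := nonempty
    exact (mem hs).2 ⟨zero.le, zero ▸ (mem hs).1⟩

namespace IsHybridTimeDomain

theorem zero_mem (hD : IsHybridTimeDomain D) : (0, 0) ∈ D :=
  let ⟨_, ht⟩ := hD.exists_hasStartTimes
  ht.zero_mem

theorem nonneg (hD : IsHybridTimeDomain D) {p : ℝ × ℕ} (hp : p ∈ D) : 0 ≤ p.1 := by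
  obtain ⟨t, ht⟩ := hD.exists_hasStartTimes
  exact ht.zero ▸ (ht.mono p.2.zero_le).trans (ht.le_of_mem hp)

theorem ordConnected_slice (hD : IsHybridTimeDomain D) (j : ℕ) : (slice D j).OrdConnected := by
  obtain ⟨t, ht⟩ := hD.exists_hasStartTimes
  exact ⟨fun a ha b hb => (Icc_subset_Icc_left (ht.le_of_mem ha)).trans (ht.Icc_subset hb)⟩

theorem measurableSet_slice (hD : IsHybridTimeDomain D) (j : ℕ) : MeasurableSet (slice D j) :=
  (hD.ordConnected_slice j).measurableSet

theorem induction (hD : IsHybridTimeDomain D) {Q : ℝ → ℕ → Prop} (zero : Q 0 0)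
    (flow : ∀ j a b, a ≤ b → Icc a b ⊆ slice D j → Q a j → Q b j)
    (jump : ∀ p ∈ jumpTimes D, Q p.1 p.2 → Q p.1 (p.2 + 1)) : ∀ p ∈ D, Q p.1 p.2 := by
  obtain ⟨t, ht⟩ := hD.exists_hasStartTimes
  suffices h : ∀ j s, (s, j) ∈ D → Q s j from fun p hp => h p.2 p.1 hp
  intro j
  induction j with
  | zero =>
    exact fun s hs => flow 0 0 s (ht.zero ▸ ht.le_of_mem hs) (ht.zero ▸ ht.Icc_subset hs) zero
  | succ j ih =>
    intro s hs
    have hj : (t (j + 1), j) ∈ D := by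
      rw [← mem_slice, ht.slice_eq j.lt_succ_self hs]
      exact right_mem_Icc.2 (ht.mono j.le_succ)
    exact flow _ _ s (ht.le_of_mem hs) (ht.Icc_subset hs)
      (jump (t (j + 1), j) ⟨hj, ht.start_mem hs⟩ (ih _ hj))

theorem volume_jumpTimes_eq_zero (hD : IsHybridTimeDomain D) (j : ℕ) :
    volume {s | (s, j) ∈ jumpTimes D} = 0 := by
  obtain ⟨t, ht⟩ := hD.exists_hasStartTimes
  refine measure_mono_null (t := {t (j + 1)}) (fun s hs => ?_) (by simp)
  have hj : s ∈ slice D j := hs.1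
  rw [ht.slice_eq j.lt_succ_self hs.2] at hj
  exact hj.2.antisymm (ht.le_of_mem hs.2)

theorem firstIndex_eq (hD : IsHybridTimeDomain D) {j : ℕ} {a b s : ℝ}
    (hab : Icc a b ⊆ slice D j) (hs : s ∈ Ioc a b) : firstIndex D s = j := by
  obtain ⟨t, ht⟩ := hD.exists_hasStartTimes
  have hj : (s, j) ∈ D := hab ⟨hs.1.le, hs.2⟩
  have ha : (a, j) ∈ D := hab ⟨le_rfl, hs.1.le.trans hs.2⟩
  refine le_antisymm (Nat.sInf_le hj) (le_csInf ⟨j, hj⟩ fun i hi => ?_)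
  by_contra! hlt
  have hi' : s ∈ slice D i := hi
  rw [ht.slice_eq hlt hj] at hi'
  exact (hi'.2.trans ((ht.mono hlt).trans (ht.le_of_mem ha))).not_gt hs.1

end IsHybridTimeDomain

theorem Ioc_subset_ordinaryTimes {j : ℕ} {a b : ℝ} (hab : Icc a b ⊆ slice D j) :
    Ioc a b ⊆ ordinaryTimes D :=
  fun _ hs => ⟨j, hab (Ioc_subset_Icc_self hs)⟩

end Domain

/-! ### Truncated norms -/

section TruncNorm

variable {U : Type*} [NormedAddCommGroup U] {D : Set (ℝ × ℕ)} {u : ℝ → ℕ → U}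

theorem IsHybridTimeDomain.measurableSet_truncated (hD : IsHybridTimeDomain D) (k : ℕ) (T : ℝ) :
    MeasurableSet {s | (s, k) ∈ D \ jumpTimes D ∧ s + k ≤ T} := by
  have : {s | (s, k) ∈ D \ jumpTimes D ∧ s + k ≤ T} =
      (slice D k \ (slice D k ∩ slice D (k + 1))) ∩ Iic (T - k) := by
    ext s
    simp [jumpTimes, le_sub_iff_add_le]
  rw [this]
  exact ((hD.measurableSet_slice k).diff ((hD.measurableSet_slice k).inter
    (hD.measurableSet_slice (k + 1)))).inter measurableSet_Iic

theorem IsHybridTimeDomain.ae_enorm_le_truncNorm (hD : IsHybridTimeDomain D) (u : ℝ → ℕ → U)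
    (k : ℕ) (T : ℝ) : ∀ᵐ s : ℝ, (s, k) ∈ D → s + k ≤ T → ‖u s k‖ₑ ≤ truncNorm D u T := by
  have hess := ENNReal.ae_le_essSup
    (μ := volume.restrict {s | (s, k) ∈ D \ jumpTimes D ∧ s + k ≤ T}) (fun s => ‖u s k‖ₑ)
  rw [ae_restrict_iff' (hD.measurableSet_truncated k T)] at hess
  have hjump : ∀ᵐ s : ℝ, (s, k) ∉ jumpTimes D := by
    simpa [ae_iff] using hD.volume_jumpTimes_eq_zero k
  filter_upwards [hess, hjump] with s hs hj hmem hT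
  exact (hs ⟨⟨hmem, hj⟩, hT⟩).trans ((le_iSup (fun k : ℕ => essSup (fun s => ‖u s k‖ₑ)
    (volume.restrict {s | (s, k) ∈ D \ jumpTimes D ∧ s + k ≤ T})) k).trans (le_max_left _ _))

theorem enorm_le_truncNorm_of_mem_jumpTimes (u : ℝ → ℕ → U) {T : ℝ} {p : ℝ × ℕ}
    (hp : p ∈ jumpTimes D) (hT : p.1 + p.2 ≤ T) : ‖u p.1 p.2‖ₑ ≤ truncNorm D u T :=
  (le_iSup₂ (f := fun (p : ℝ × ℕ) (_ : p ∈ {p : ℝ × ℕ | p ∈ jumpTimes D ∧ p.1 + p.2 ≤ T}) =>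
    ‖u p.1 p.2‖ₑ) p ⟨hp, hT⟩).trans (le_max_right _ _)

theorem IsHybridTimeDomain.truncNorm_le (hD : IsHybridTimeDomain D) {T : ℝ} {M : ℝ≥0∞}
    (hflow : ∀ k : ℕ, ∀ᵐ s : ℝ, (s, k) ∈ D → s + k ≤ T → ‖u s k‖ₑ ≤ M)
    (hjump : ∀ p ∈ jumpTimes D, p.1 + p.2 ≤ T → ‖u p.1 p.2‖ₑ ≤ M) : truncNorm D u T ≤ M := by
  refine max_le (iSup_le fun k => essSup_le_of_ae_le _ ?_)
    (iSup₂_le fun p hp => hjump p hp.1 hp.2)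
  rw [EventuallyLE, ae_restrict_iff' (hD.measurableSet_truncated k T)]
  filter_upwards [hflow k] with s hs hm
  exact hs hm.1.1 hm.2

theorem IsZeroInput.isBoundedOnBounded (hu : IsZeroInput D u) (hD : IsHybridTimeDomain D) :
    IsBoundedOnBounded D u := by
  refine fun T => (hD.truncNorm_le (M := 0) (fun k => .of_forall fun s hs _ => ?_)
    fun p hp _ => ?_).trans_lt ENNReal.zero_lt_top
  · simp [hu (s, k) hs]
  · simp [hu p hp.1]

theorem IsHybridTimeDomain.ae_norm_le_supNorm (hD : IsHybridTimeDomain D)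
    (hu : supNorm D u < ∞) (k : ℕ) :
    ∀ᵐ s : ℝ, (s, k) ∈ D → ‖u s k‖ ≤ (supNorm D u).toReal := by
  have h : ∀ᵐ s : ℝ, ∀ n : ℕ, (s, k) ∈ D → s + k ≤ (n : ℝ) → ‖u s k‖ₑ ≤ truncNorm D u n :=
    ae_all_iff.2 fun n => hD.ae_enorm_le_truncNorm u k n
  filter_upwards [h] with s hs hm
  obtain ⟨n, hn⟩ := exists_nat_ge (s + k)
  simpa using ENNReal.toReal_mono hu.ne
    ((hs n hm hn).trans (le_iSup (fun T : ℝ => truncNorm D u T) n))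

theorem norm_le_supNorm_of_mem_jumpTimes (hu : supNorm D u < ∞) {p : ℝ × ℕ}
    (hp : p ∈ jumpTimes D) : ‖u p.1 p.2‖ ≤ (supNorm D u).toReal := by
  simpa using ENNReal.toReal_mono hu.ne ((enorm_le_truncNorm_of_mem_jumpTimes u hp le_rfl).trans
    (le_iSup (fun T : ℝ => truncNorm D u T) _))

end TruncNorm

/-! ### Extension of solutions and completeness -/

section Glue

variable {U : Type*} {D D' : Set (ℝ × ℕ)} {f g : ℝ → ℕ → U} {t : ℝ} {j : ℕ}

open scoped Classical in
/-- The hybrid signal that agrees with `f` on `D` and with `g` elsewhere; `glue D u 0` extends the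
input `u` by zero. -/
def glue (D : Set (ℝ × ℕ)) (f g : ℝ → ℕ → U) (t : ℝ) (j : ℕ) : U :=
  if (t, j) ∈ D then f t j else g t j

theorem glue_of_mem (h : (t, j) ∈ D) : glue D f g t j = f t j := if_pos h

theorem glue_of_notMem (h : (t, j) ∉ D) : glue D f g t j = g t j := if_neg h

variable [NormedAddCommGroup U] {u : ℝ → ℕ → U}

theorem IsZeroInput.glue_zero (hu : IsZeroInput D u) (D' : Set (ℝ × ℕ)) :
    IsZeroInput D' (glue D u 0) := by
  intro p _
  by_cases h : (p.1, p.2) ∈ D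
  · exact (glue_of_mem h).trans (hu p h)
  · exact glue_of_notMem h

theorem IsHybridInput.glue_zero (hu : IsHybridInput D u) (hD : IsHybridTimeDomain D)
    (hb : IsBoundedOnBounded D u) (D' : Set (ℝ × ℕ)) : IsHybridInput D' (glue D u 0) := by
  refine fun j => ⟨?_, fun a b _ => ⟨(truncNorm D u (b + j)).toReal, ?_⟩⟩
  · have h : (fun t => glue D u 0 t j) = (slice D j).indicator (fun t => u t j) := by
      ext t
      by_cases h : (t, j) ∈ D
      · rw [glue_of_mem h, indicator_of_mem (mem_slice.2 h)]
      · rw [glue_of_notMem h, indicator_of_notMem (mt mem_slice.1 h)]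
        rfl
    rw [h]
    exact ((aestronglyMeasurable_indicator_iff (hD.measurableSet_slice j)).2 (hu j).1).mono_measure
      Measure.restrict_le_self
  · rw [ae_restrict_iff' measurableSet_Icc]
    filter_upwards [hD.ae_enorm_le_truncNorm u j (b + j)] with t ht htb
    by_cases h : (t, j) ∈ D
    · rw [glue_of_mem h]
      simpa using ENNReal.toReal_mono (hb _).ne (ht h (by linarith [htb.2]))
    · simp [glue_of_notMem h]

theorem IsBoundedOnBounded.glue_zero (hb : IsBoundedOnBounded D u) (hD : IsHybridTimeDomain D)
    (hD' : IsHybridTimeDomain D') (q : ℝ × ℕ) (hq : jumpTimes D' ⊆ insert q (jumpTimes D)) :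
    IsBoundedOnBounded D' (glue D u 0) := by
  intro T
  refine (hD'.truncNorm_le (M := max (truncNorm D u T) ‖glue D u 0 q.1 q.2‖ₑ)
    (fun k => ?_) fun p hp hT => ?_).trans_lt (max_lt (hb T) enorm_lt_top)
  · filter_upwards [hD.ae_enorm_le_truncNorm u k T] with s hs _ hT
    by_cases h : (s, k) ∈ D
    · rw [glue_of_mem h]
      exact (hs h hT).trans (le_max_left _ _)
    · simp [glue_of_notMem h]
  · rcases hq hp with rfl | h
    · exact le_max_right _ _
    · rw [glue_of_mem h.1]
      exact (enorm_le_truncNorm_of_mem_jumpTimes u h hT).trans (le_max_left _ _)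

end Glue

section LastIndex

variable {D : Set (ℝ × ℕ)} {t : ℕ → ℝ} {J : ℕ} {T T' : ℝ}

/-- The hybrid time domain `D` ends with the interval of index `J`, which starts at `t J`; the
earlier intervals are `[t j, t (j + 1)]`. -/
structure HasLastIndex (D : Set (ℝ × ℕ)) (t : ℕ → ℝ) (J : ℕ) : Prop where
  zero : t 0 = 0
  mono : Monotone t
  slice_of_lt : ∀ j < J, slice D j = Icc (t j) (t (j + 1))
  slice_of_gt : ∀ j, J < j → slice D j = ∅

theorem IsHybridTimeDomain.exists_hasLastIndex (hD : IsHybridTimeDomain D) {r : ℝ}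
    (hr : ∀ p ∈ D, p.1 + p.2 < r) :
    ∃ t J T, HasLastIndex D t J ∧
      (t J ≤ T ∧ slice D J = Icc (t J) T ∨ t J < T ∧ slice D J = Ico (t J) T) := by
  obtain ⟨t, zero, mono, hinf | ⟨J, hlt, hgt, hJ⟩⟩ := hD
  · obtain ⟨n, hn⟩ := exists_nat_ge r
    have hmem : t n ∈ slice D n := hinf n ▸ left_mem_Icc.2 (mono n.le_succ)
    have := hr (t n, n) hmem
    have := zero ▸ mono n.zero_le
    simp only at *
    linarith
  · have hlast : HasLastIndex D t J := ⟨zero, mono, hlt, hgt⟩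
    rcases hJ with ⟨T, hJ⟩ | ⟨T, hJ⟩ | hJ
    · exact ⟨t, J, T, hlast, .inl hJ⟩
    · exact ⟨t, J, T, hlast, .inr hJ⟩
    · have hmem : max (t J) r ∈ slice D J := hJ ▸ mem_Ici.2 (le_max_left _ _)
      have := hr (max (t J) r, J) hmem
      have := le_max_right (t J) r
      have := J.cast_nonneg (α := ℝ)
      simp only at *
      linarith

theorem slice_union_prod_singleton (D : Set (ℝ × ℕ)) (I : Set ℝ) (J : ℕ) :
    slice (D ∪ I ×ˢ {J}) J = slice D J ∪ I := by
  ext s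
  simp

theorem slice_union_prod_singleton_of_ne {j : ℕ} (hj : j ≠ J) (D : Set (ℝ × ℕ)) (I : Set ℝ) :
    slice (D ∪ I ×ˢ {J}) j = slice D j := by
  ext s
  simp [hj]

theorem slice_insert_of_ne {j : ℕ} (hj : j ≠ J) (D : Set (ℝ × ℕ)) (T : ℝ) :
    slice (insert (T, J) D) j = slice D j := by
  ext s
  simp [hj]

namespace HasLastIndex

theorem le_of_mem (h : HasLastIndex D t J) {s : ℝ} {j : ℕ} (hs : (s, j) ∈ D) : j ≤ J := by
  by_contra! hlt
  exact (h.slice_of_gt j hlt ▸ mem_slice.2 hs : s ∈ (∅ : Set ℝ))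

theorem slice_insert (h : HasLastIndex D t J) (T : ℝ) :
    slice (insert (T, J + 1) D) (J + 1) = {T} := by
  ext s
  simpa using fun hs : (s, J + 1) ∈ D => absurd (h.le_of_mem hs) (by simp)

theorem isHybridTimeDomain_union (h : HasLastIndex D t J) (hT : t J ≤ T)
    (hsub : slice D J ⊆ Icc (t J) T) : IsHybridTimeDomain (D ∪ Icc (t J) T ×ˢ {J}) := by
  refine ⟨t, h.zero, h.mono, .inr ⟨J, fun j hj => ?_, fun j hj => ?_, .inl ⟨T, hT, ?_⟩⟩⟩
  · rw [slice_union_prod_singleton_of_ne hj.ne, h.slice_of_lt j hj]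
  · rw [slice_union_prod_singleton_of_ne hj.ne', h.slice_of_gt j hj]
  · rw [slice_union_prod_singleton, union_eq_right.2 hsub]

theorem isHybridTimeDomain_insert (h : HasLastIndex D t J) (hT : t J ≤ T)
    (hJ : slice D J = Icc (t J) T) : IsHybridTimeDomain (insert (T, J + 1) D) := by
  refine ⟨fun j => if j ≤ J then t j else T, by simp [h.zero], fun i j hij => ?_,
    .inr ⟨J + 1, fun j hj => ?_, fun j hj => ?_, .inl ⟨T, by simp, by simp [h.slice_insert]⟩⟩⟩
  · dsimp only
    split_ifs with hi hj hj
    exacts [h.mono hij, (h.mono hi).trans hT, absurd (hij.trans hj) hi, le_rfl]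
  · rw [slice_insert_of_ne hj.ne]
    rcases (Nat.lt_succ_iff.1 hj).eq_or_lt with rfl | hlt
    · simp [hJ]
    · simp [h.slice_of_lt j hlt, hlt.le, Nat.succ_le_iff.2 hlt]
  · rw [slice_insert_of_ne hj.ne', h.slice_of_gt j (by omega)]

theorem jumpTimes_union_subset (h : HasLastIndex D t J) (hJ : (t J, J) ∈ D) (T : ℝ) :
    jumpTimes (D ∪ Icc (t J) T ×ˢ {J}) ⊆ jumpTimes D := by
  rintro ⟨s, j⟩ ⟨hs, hs'⟩
  have hjJ : j + 1 ≤ J := by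
    rcases hs' with hs' | ⟨-, hs'⟩
    exacts [h.le_of_mem hs', hs'.le]
  have hsD : (s, j) ∈ D := hs.resolve_right fun hmem => absurd hmem.2 (Nat.ne_of_lt hjJ)
  refine ⟨hsD, hs'.elim id fun hs' => ?_⟩
  obtain rfl : j + 1 = J := hs'.2
  rw [← mem_slice, h.slice_of_lt j j.lt_succ_self] at hsD
  rwa [show s = t (j + 1) from hsD.2.antisymm hs'.1.1]

theorem jumpTimes_insert_subset (h : HasLastIndex D t J) (T : ℝ) :
    jumpTimes (insert (T, J + 1) D) ⊆ insert (T, J) (jumpTimes D) := by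
  rintro ⟨s, j⟩ ⟨hs, hs' | hs'⟩
  · exact .inl (by simpa using hs')
  · refine .inr ⟨hs.resolve_left fun heq => ?_, hs'⟩
    have := h.le_of_mem hs'
    simp only [Prod.mk.injEq] at heq
    omega

end HasLastIndex

end LastIndex

section Extension

variable {X W V : Type*} [NormedAddCommGroup X] [NormedSpace ℝ X]
  [NormedAddCommGroup W] [NormedAddCommGroup V] {H : HybridSystem X W V}
  {D : Set (ℝ × ℕ)} {φ : ℝ → ℕ → X} {u : ℝ → ℕ → WithLp 2 (W × V)}

namespace IsSolutionPair

theorem mem_flowSet (hs : IsSolutionPair H D φ u) (hcl : IsClosed H.flowSet)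
    (hJ : H.jumpSet ⊆ H.flowSet) (hG : ∀ x ∈ H.jumpSet, ∀ η, H.jumpMap x η ⊆ H.flowSet) :
    ∀ p ∈ D, φ p.1 p.2 ∈ H.flowSet := by
  refine hs.domain.induction (Q := fun t j => φ t j ∈ H.flowSet) ?_ (fun j a b hab hI ha => ?_)
    fun p hp _ => hG _ (hs.jump p hp).1 _ (hs.jump p hp).2
  · exact hs.init.elim (fun h => hcl.closure_eq ▸ h) fun h => hJ h
  rcases hab.eq_or_lt with rfl | hlt
  · exact ha
  have hc : ContinuousOn (fun t => φ t j) (Icc a b) := by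
    simpa [uIcc_of_le hab] using (hs.arc j a b hab hI).continuousOn
  have hb : b ∈ closure (Ioo a b) := by
    rw [closure_Ioo hlt.ne]
    exact right_mem_Icc.2 hab
  have hflow : MapsTo (fun t => φ t j) (Ioo a b) H.flowSet := fun t ht =>
    hs.flow_mem j t (interior_maximal (Ioo_subset_Icc_self.trans hI) isOpen_Ioo ht)
  simpa [hcl.closure_eq] using
    ((hc b (right_mem_Icc.2 hab)).mono Ioo_subset_Icc_self).mem_closure hb hflow

theorem ae_hasDerivAt (hs : IsSolutionPair H D φ u) (j : ℕ) :
    ∀ᵐ t, t ∈ interior (slice D j) →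
      HasDerivAt (fun s => φ s j) (H.flowMap (φ t j) (u t j).fst) t :=
  (ae_restrict_iff' isOpen_interior.measurableSet).1 (hs.flow_eq j)

end IsSolutionPair

/-- The solution pair `(φ, u)` has a proper extension whose input is zero outside the original
domain and bounded on bounded sets. -/
def IsExtendible (H : HybridSystem X W V) (D : Set (ℝ × ℕ)) (φ : ℝ → ℕ → X)
    (u : ℝ → ℕ → WithLp 2 (W × V)) : Prop :=
  ∃ D' φ', D ⊂ D' ∧ (∀ p ∈ D, φ' p.1 p.2 = φ p.1 p.2) ∧ IsSolutionPair H D' φ' (glue D u 0) ∧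
    IsBoundedOnBounded D' (glue D u 0)

namespace IsSolutionPair

theorem isExtendible (hs : IsSolutionPair H D φ u) (hb : IsBoundedOnBounded D u)
    {D' : Set (ℝ × ℕ)} (hDD' : D ⊂ D') (hD' : IsHybridTimeDomain D') {φ' : ℝ → ℕ → X}
    (hφ : ∀ p ∈ D, φ' p.1 p.2 = φ p.1 p.2) {m : ℕ} (hm : ∀ j ≠ m, slice D' j = slice D j)
    (arc : ∀ a b, a ≤ b → Icc a b ⊆ slice D' m →
      AbsolutelyContinuousOnInterval (fun t => φ' t m) a b)
    (flow_mem : ∀ t ∈ interior (slice D' m), φ' t m ∈ H.flowSet)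
    (flow_eq : ∀ᵐ t, t ∈ interior (slice D' m) →
      HasDerivAt (fun s => φ' s m) (H.flowMap (φ' t m) (glue D u 0 t m).fst) t)
    (q : ℝ × ℕ) (hq : jumpTimes D' ⊆ insert q (jumpTimes D))
    (jump : q ∈ jumpTimes D' → φ' q.1 q.2 ∈ H.jumpSet ∧
      φ' q.1 (q.2 + 1) ∈ H.jumpMap (φ' q.1 q.2) (glue D u 0 q.1 q.2).snd) :
    IsExtendible H D φ u := by
  refine ⟨D', φ', hDD', hφ, ⟨hD', hs.input.glue_zero hs.domain hb D', fun j a b hab hI => ?_, ?_,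
    fun j t ht => ?_, fun j => ?_, fun p hp => ?_⟩, hb.glue_zero hs.domain hD' q hq⟩
  · rcases eq_or_ne j m with rfl | hj
    · exact arc a b hab hI
    rw [hm j hj] at hI
    refine absolutelyContinuousOnInterval_congr (hs.arc j a b hab hI) fun t ht => ?_
    exact (hφ (t, j) (hI (uIcc_of_le hab ▸ ht))).symm
  · exact hφ (0, 0) hs.domain.zero_mem ▸ hs.init
  · rcases eq_or_ne j m with rfl | hj
    · exact flow_mem t ht
    rw [hm j hj] at ht
    exact hφ (t, j) (mem_slice.1 (interior_subset ht)) ▸ hs.flow_mem j t ht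
  · rw [ae_restrict_iff' isOpen_interior.measurableSet]
    rcases eq_or_ne j m with rfl | hj
    · exact flow_eq
    rw [hm j hj]
    filter_upwards [hs.ae_hasDerivAt j] with t ht hmem
    have htD : (t, j) ∈ D := mem_slice.1 (interior_subset hmem)
    rw [glue_of_mem htD, show φ' t j = φ t j from hφ (t, j) htD]
    refine (ht hmem).congr_of_eventuallyEq ?_
    filter_upwards [isOpen_interior.mem_nhds hmem] with s hs
    exact hφ (s, j) (mem_slice.1 (interior_subset hs))
  · rcases hq hp with rfl | h
    · exact jump hp
    · rw [hφ _ h.1, hφ (p.1, p.2 + 1) h.2, glue_of_mem h.1]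
      exact hs.jump p h

variable {t : ℕ → ℝ} {J : ℕ} {T : ℝ}

theorem isExtendible_of_flow (hs : IsSolutionPair H D φ u) (hb : IsBoundedOnBounded D u)
    (h : HasLastIndex D t J) {χ : ℝ → X} (hT : t J < T) (hJ : (t J, J) ∈ D) (hTD : (T, J) ∉ D)
    (hsub : slice D J ⊆ Icc (t J) T) (hφ : ∀ s ∈ slice D J, χ s = φ s J)
    (hac : AbsolutelyContinuousOnInterval χ (t J) T) (hmem : ∀ s ∈ Ioo (t J) T, χ s ∈ H.flowSet)
    (hder : ∀ᵐ s, s ∈ Ioo (t J) T →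
      HasDerivAt χ (H.flowMap (χ s) (glue D u 0 s J).fst) s) : IsExtendible H D φ u := by
  have hslice : slice (D ∪ Icc (t J) T ×ˢ {J}) J = Icc (t J) T := by
    rw [slice_union_prod_singleton, union_eq_right.2 hsub]
  have hχ : ∀ s, glue D φ (fun s _ => χ s) s J = χ s := fun s => by
    by_cases hsD : (s, J) ∈ D
    · rw [glue_of_mem hsD, hφ s hsD]
    · exact glue_of_notMem hsD
  refine hs.isExtendible hb (D' := D ∪ Icc (t J) T ×ˢ {J}) (φ' := glue D φ fun s _ => χ s)
    ((ssubset_iff_of_subset subset_union_left).2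
      ⟨(T, J), .inr ⟨right_mem_Icc.2 hT.le, rfl⟩, hTD⟩)
    (h.isHybridTimeDomain_union hT.le hsub) (fun p hp => glue_of_mem hp)
    (fun j hj => slice_union_prod_singleton_of_ne hj D _) ?_ ?_ ?_ (0, 0)
    ((h.jumpTimes_union_subset hJ T).trans (subset_insert _ _)) fun h0 => ?_
  · intro a b hab hI
    simp only [hχ]
    rw [hslice] at hI
    exact hac.mono (by rwa [uIcc_of_le hab, uIcc_of_le hT.le])
  · simpa only [hslice, interior_Icc, hχ] using hmem
  · simpa only [hslice, interior_Icc, hχ] using hder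
  · have h0 := h.jumpTimes_union_subset hJ T h0
    rw [glue_of_mem h0.1, glue_of_mem h0.2, glue_of_mem h0.1]
    exact hs.jump _ h0

theorem isExtendible_of_jump (hs : IsSolutionPair H D φ u) (hb : IsBoundedOnBounded D u)
    (h : HasLastIndex D t J) (hT : t J ≤ T) (hJ : slice D J = Icc (t J) T)
    (hjump : φ T J ∈ H.jumpSet) (hne : (H.jumpMap (φ T J) (u T J).snd).Nonempty) :
    IsExtendible H D φ u := by
  obtain ⟨g, hg⟩ := hne
  have hTD : (T, J) ∈ D := by
    rw [← mem_slice, hJ]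
    exact right_mem_Icc.2 hT
  have hnD : (T, J + 1) ∉ D := fun hmem => absurd (h.le_of_mem hmem) (by simp)
  refine hs.isExtendible hb (φ' := glue D φ fun _ _ => g) (ssubset_insert hnD)
    (h.isHybridTimeDomain_insert hT hJ) (fun p hp => glue_of_mem hp)
    (fun j hj => slice_insert_of_ne hj D T) ?_ (by simp [h.slice_insert])
    (by simp [h.slice_insert]) (T, J) (h.jumpTimes_insert_subset T) fun _ => ?_
  · intro a b hab hI
    rw [h.slice_insert] at hI
    rw [hI (left_mem_Icc.2 hab), hI (right_mem_Icc.2 hab)]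
    exact LipschitzOnWith.absolutelyContinuousOnInterval (K := 0) (by simp)
  · simpa only [glue_of_mem hTD, glue_of_notMem hnD] using ⟨hjump, hg⟩

theorem isExtendible_of_isFlow (hs : IsSolutionPair H D φ u) (hb : IsBoundedOnBounded D u)
    (h : HasLastIndex D t J) (hT : t J ≤ T) (hJ : slice D J = Icc (t J) T)
    (hmem : ∀ p ∈ D, φ p.1 p.2 ∈ H.flowSet) {b : ℝ} (hb0 : 0 < b) {ξ : ℝ → X}
    (hξ0 : ξ 0 = φ T J) (hac : AbsolutelyContinuousOnInterval ξ 0 b)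
    (hξ : ∀ s ∈ Ioo 0 b, HasDerivAt ξ (H.flowMap (ξ s) 0) s ∧ ξ s ∈ H.flowSet) :
    IsExtendible H D φ u := by
  have hJD : ∀ s, (s, J) ∈ D ↔ s ∈ Icc (t J) T := fun s => by rw [← mem_slice, hJ]
  have hξT : ∀ s ∈ Ioo T (T + b), HasDerivAt ξ (H.flowMap (ξ (s - T)) 0) (s - T) ∧
      ξ (s - T) ∈ H.flowSet := fun s hs =>
    hξ _ ⟨sub_pos.2 hs.1, sub_lt_iff_lt_add'.2 hs.2⟩
  refine hs.isExtendible_of_flow hb h (T := T + b)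
    (χ := fun s => if s ≤ T then φ s J else ξ (s - T)) (by linarith)
    ((hJD _).2 (left_mem_Icc.2 hT)) (fun hm => by linarith [((hJD _).1 hm).2])
    (hJ ▸ Icc_subset_Icc_right (by linarith)) (fun s hs => if_pos ((hJD s).1 hs).2) ?_
    (fun s hs => ?_) ?_
  · refine absolutelyContinuousOnInterval_ite hT (by linarith) (hs.arc J _ _ hT hJ.ge)
      (absolutelyContinuousOnInterval_comp_monotone (p := fun s => s - T) hac
        (fun _ _ h => sub_le_sub_right h T) (LipschitzWith.of_dist_le_mul fun x y => by simp) ?_)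
      (by simp [hξ0])
    rw [uIcc_of_le (by linarith), uIcc_of_le hb0.le]
    exact fun s hs => ⟨sub_nonneg.2 hs.1, sub_le_iff_le_add'.2 hs.2⟩
  · split_ifs with hsT
    · exact hmem (s, J) ((hJD s).2 ⟨hs.1.le, hsT⟩)
    · exact (hξT s ⟨not_le.1 hsT, hs.2⟩).2
  · have hne : ∀ᵐ s : ℝ, s ≠ T := by simp [ae_iff]
    filter_upwards [hs.ae_hasDerivAt J, hne] with s hf hsT hsI
    rw [hJ, interior_Icc] at hf
    rcases hsT.lt_or_gt with hlt | hgt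
    · rw [if_pos hlt.le, glue_of_mem ((hJD s).2 ⟨hsI.1.le, hlt.le⟩)]
      exact (hf ⟨hsI.1, hlt⟩).congr_of_eventuallyEq
        (mem_of_superset (Iic_mem_nhds hlt) fun r hr => if_pos hr)
    · rw [if_neg hgt.not_ge, glue_of_notMem fun hm => hgt.not_ge ((hJD s).1 hm).2]
      exact ((hξT s ⟨hgt, hsI.2⟩).1.comp_sub_const s T).congr_of_eventuallyEq
        (mem_of_superset (Ioi_mem_nhds hgt) fun r hr => if_neg (not_le.2 hr))

end IsSolutionPair

end Extension

section Viability

variable {X W V : Type*} [NormedAddCommGroup X] [InnerProductSpace ℝ X]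
  [NormedAddCommGroup W] [NormedAddCommGroup V] {H : HybridSystem X W V}
  {D : Set (ℝ × ℕ)} {φ : ℝ → ℕ → X} {u : ℝ → ℕ → WithLp 2 (W × V)}

/-- Conditions under which every solution on a bounded domain can be extended: the flow map has
linear growth, and from each point of the flow set it is possible to jump, or to flow for some
time with zero disturbance. -/
structure IsViable (H : HybridSystem X W V) : Prop where
  isClosed : IsClosed H.flowSet
  growth : ∃ k : ℝ, 0 ≤ k ∧ ∀ x w, ‖H.flowMap x w‖ ≤ k * (‖x‖ + ‖w‖ + 1)
  jumpSet_subset : H.jumpSet ⊆ H.flowSet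
  jumpMap_subset : ∀ x ∈ H.jumpSet, ∀ η, H.jumpMap x η ⊆ H.flowSet
  jump_or_flow : ∀ x ∈ H.flowSet, (x ∈ H.jumpSet ∧ ∀ η, (H.jumpMap x η).Nonempty) ∨
    ∃ b > 0, ∃ ξ : ℝ → X, ξ 0 = x ∧ AbsolutelyContinuousOnInterval ξ 0 b ∧
      ∀ s ∈ Ioo 0 b, HasDerivAt ξ (H.flowMap (ξ s) 0) s ∧ ξ s ∈ H.flowSet

variable [FiniteDimensional ℝ X]

theorem IsSolutionPair.exists_lipschitzOnWith_Ico (hs : IsSolutionPair H D φ u)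
    (hb : IsBoundedOnBounded D u)
    (hgrowth : ∃ k : ℝ, 0 ≤ k ∧ ∀ x w, ‖H.flowMap x w‖ ≤ k * (‖x‖ + ‖w‖ + 1))
    {J : ℕ} {a T : ℝ} (hJ : slice D J = Ico a T) :
    ∃ K, LipschitzOnWith K (fun t => φ t J) (Ico a T) := by
  obtain ⟨k, hk, hgrowth⟩ := hgrowth
  set M := (truncNorm D u (T + J)).toReal
  refine exists_lipschitzOnWith_Ico_of_ae_norm_deriv_le (k := k * (M + 1))
    (f' := fun t => H.flowMap (φ t J) (u t J).fst) (by positivity)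
    (fun t ht => hs.arc J a t ht.1 (hJ ▸ Icc_subset_Ico_right ht.2)) ?_
  filter_upwards [hs.ae_hasDerivAt J, hs.domain.ae_enorm_le_truncNorm u J (T + J)]
    with t hder hu ht
  rw [hJ, interior_Ico] at hder
  have htD : t ∈ slice D J := hJ ▸ Ioo_subset_Ico_self ht
  have hw : ‖(u t J).fst‖ ≤ M := (WithLp.norm_fst_le _ _).trans <| by
    simpa using ENNReal.toReal_mono (hb _).ne (hu htD (by linarith [ht.2]))
  refine ⟨hder ht, (hgrowth _ _).trans ?_⟩
  rw [mul_assoc]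
  refine mul_le_mul_of_nonneg_left ?_ hk
  nlinarith [mul_nonneg (ENNReal.toReal_nonneg : 0 ≤ M) (norm_nonneg (φ t J))]

theorem IsSolutionPair.isExtendible_of_slice_eq_Ico (hs : IsSolutionPair H D φ u)
    (hb : IsBoundedOnBounded D u)
    (hgrowth : ∃ k : ℝ, 0 ≤ k ∧ ∀ x w, ‖H.flowMap x w‖ ≤ k * (‖x‖ + ‖w‖ + 1))
    (hmem : ∀ p ∈ D, φ p.1 p.2 ∈ H.flowSet) {t : ℕ → ℝ} {J : ℕ} {T : ℝ}
    (h : HasLastIndex D t J) (hT : t J < T) (hJ : slice D J = Ico (t J) T) :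
    IsExtendible H D φ u := by
  have hJD : ∀ s, (s, J) ∈ D ↔ s ∈ Ico (t J) T := fun s => by rw [← mem_slice, hJ]
  obtain ⟨K, hK⟩ := hs.exists_lipschitzOnWith_Ico hb hgrowth hJ
  obtain ⟨χ, hχ, hχφ⟩ := hK.extend_finite_dimension
  refine hs.isExtendible_of_flow hb h hT ((hJD _).2 (left_mem_Ico.2 hT))
    (fun hTD => lt_irrefl _ ((hJD _).1 hTD).2) (hJ ▸ Ico_subset_Icc_self)
    (fun s hs => (hχφ ((hJD s).1 hs)).symm) hχ.lipschitzOnWith.absolutelyContinuousOnInterval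
    (fun s hs => ?_) ?_
  · have hsI := Ioo_subset_Ico_self hs
    rw [← hχφ hsI]
    exact hmem (s, J) ((hJD s).2 hsI)
  · filter_upwards [hs.ae_hasDerivAt J] with s hder hs
    rw [hJ, interior_Ico] at hder
    have hsI := Ioo_subset_Ico_self hs
    rw [← hχφ hsI, glue_of_mem ((hJD s).2 hsI)]
    refine (hder hs).congr_of_eventuallyEq ?_
    filter_upwards [Ioo_mem_nhds hs.1 hs.2] with r hr
    exact (hχφ (Ioo_subset_Ico_self hr)).symm

namespace IsViable

theorem isExtendible (hH : IsViable H) (hs : IsSolutionPair H D φ u)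
    (hb : IsBoundedOnBounded D u) {r : ℝ} (hr : ∀ p ∈ D, p.1 + p.2 < r) :
    IsExtendible H D φ u := by
  have hmem := hs.mem_flowSet hH.isClosed hH.jumpSet_subset hH.jumpMap_subset
  obtain ⟨t, J, T, h, ⟨hT, hJ⟩ | ⟨hT, hJ⟩⟩ := hs.domain.exists_hasLastIndex hr
  · have hTD : T ∈ slice D J := hJ ▸ right_mem_Icc.2 hT
    rcases hH.jump_or_flow _ (hmem (T, J) hTD) with ⟨hjump, hne⟩ | ⟨b, hb0, ξ, hξ0, hac, hξ⟩
    · exact hs.isExtendible_of_jump hb h hT hJ hjump (hne _)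
    · exact hs.isExtendible_of_isFlow hb h hT hJ hmem hb0 hξ0 hac hξ
  · exact hs.isExtendible_of_slice_eq_Ico hb hH.growth hmem h hT hJ

theorem maximalAreComplete_isBoundedOnBounded (hH : IsViable H) :
    MaximalAreComplete H IsBoundedOnBounded := by
  intro D φ u hs hb hmax
  by_contra! hr
  obtain ⟨r, hr⟩ := hr
  obtain ⟨D', φ', hss, hφ, hs', hb'⟩ := hH.isExtendible hs hb hr
  exact hss.ne' (hmax D' φ' _ hs' hb' hss.subset fun p hp => ⟨hφ p hp, glue_of_mem hp⟩)

theorem maximalAreComplete_isZeroInput (hH : IsViable H) : MaximalAreComplete H IsZeroInput := by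
  intro D φ u hs hz hmax
  by_contra! hr
  obtain ⟨r, hr⟩ := hr
  obtain ⟨D', φ', hss, hφ, hs', -⟩ := hH.isExtendible hs (hz.isBoundedOnBounded hs.domain) hr
  exact hss.ne' (hmax D' φ' _ hs' (hz.glue_zero D') hss.subset
    fun p hp => ⟨hφ p hp, glue_of_mem hp⟩)

end IsViable

end Viability

/-! ### Timers and hybrid Grönwall inequality -/

/-- A countdown timer on the hybrid time domain `D`: it decreases at unit rate during flows, it has
reached `0` whenever `D` jumps, and it is at least `T₁` after the jump. -/
structure IsTimer (D : Set (ℝ × ℕ)) (T₁ T₂ : ℝ) (τ : ℝ → ℕ → ℝ) : Prop where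
  domain : IsHybridTimeDomain D
  mem_Icc : ∀ p ∈ D, τ p.1 p.2 ∈ Icc 0 T₂
  flow : ∀ j a b, a ≤ b → Icc a b ⊆ slice D j → τ b j = τ a j - (b - a)
  eq_zero : ∀ p ∈ jumpTimes D, τ p.1 p.2 = 0
  le_reset : ∀ p ∈ jumpTimes D, T₁ ≤ τ p.1 (p.2 + 1)

namespace IsTimer

variable {D : Set (ℝ × ℕ)} {T₁ T₂ c G K : ℝ} {τ v : ℝ → ℕ → ℝ}

theorem mul_index_le (hτ : IsTimer D T₁ T₂ τ) {p : ℝ × ℕ} (hp : p ∈ D) :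
    T₁ * p.2 ≤ p.1 + T₂ := by
  have invariant : ∀ p ∈ D, T₁ * p.2 ≤ p.1 + τ p.1 p.2 := by
    refine hτ.domain.induction (Q := fun t j => T₁ * j ≤ t + τ t j) ?_ ?_ ?_
    · simpa using (hτ.mem_Icc _ hτ.domain.zero_mem).1
    · intro j a b hab hI ha
      linarith [hτ.flow j a b hab hI]
    · intro p hp hQ
      rw [hτ.eq_zero p hp] at hQ
      push_cast
      linarith [hτ.le_reset p hp]
  exact (invariant p hp).trans (by gcongr; exact (hτ.mem_Icc p hp).2)

theorem exp_neg_mul_le (hτ : IsTimer D T₁ T₂ τ) (hT₁ : 0 ≤ T₁) (hc : 0 ≤ c) {p : ℝ × ℕ}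
    (hp : p ∈ D) :
    Real.exp (-c * p.1) ≤ Real.exp (c * T₂) * Real.exp (-(c * T₁ / (1 + T₁)) * (p.1 + p.2)) := by
  have hT₂ : 0 ≤ T₂ := (hτ.mem_Icc p hp).1.trans (hτ.mem_Icc p hp).2
  have key : c * T₁ / (1 + T₁) * (p.1 + p.2) ≤ c * (p.1 + T₂) := by
    rw [div_mul_eq_mul_div, div_le_iff₀ (by positivity), mul_assoc, mul_assoc]
    refine mul_le_mul_of_nonneg_left ?_ hc
    linarith [hτ.mul_index_le hp, mul_nonneg hT₁ hT₂]
  rw [← Real.exp_add, Real.exp_le_exp]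
  linarith

/-- Each jump adds at most `K`, but consecutive jumps are `T₁` apart: with `B` as in the proof, the
term `B e^{c τ}` of the invariant pays for the next jump because `B + K = B e^{c T₁}`. -/
theorem le_exp_neg_mul_add (hτ : IsTimer D T₁ T₂ τ) (hT₁ : 0 < T₁) (hc : 0 < c) (hG : 0 ≤ G)
    (hK : 0 ≤ K)
    (hflow : ∀ j a b, a ≤ b → Icc a b ⊆ slice D j →
      v b j ≤ G + Real.exp (-c * (b - a)) * (v a j - G))
    (hjump : ∀ p ∈ jumpTimes D, v p.1 (p.2 + 1) ≤ v p.1 p.2 + K) {p : ℝ × ℕ} (hp : p ∈ D) :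
    v p.1 p.2 ≤ Real.exp (-c * p.1) * v 0 0 +
      (G + K / (Real.exp (c * T₁) - 1) * Real.exp (c * T₂)) := by
  have hr : 0 < Real.exp (c * T₁) - 1 := sub_pos.2 (Real.one_lt_exp_iff.2 (by positivity))
  set B := K / (Real.exp (c * T₁) - 1)
  have : 0 ≤ B := by positivity
  have hBK : B + K = B * Real.exp (c * T₁) := by
    have : B * (Real.exp (c * T₁) - 1) = K := div_mul_cancel₀ K hr.ne'
    linarith
  have invariant : ∀ p ∈ D,
      v p.1 p.2 ≤ Real.exp (-c * p.1) * v 0 0 + G + B * Real.exp (c * τ p.1 p.2) := by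
    refine hτ.domain.induction
      (Q := fun t j => v t j ≤ Real.exp (-c * t) * v 0 0 + G + B * Real.exp (c * τ t j)) ?_ ?_ ?_
    · rw [mul_zero, Real.exp_zero, one_mul, add_assoc]
      exact le_add_of_nonneg_right (by positivity)
    · intro j a b hab hI ha
      have e₁ : Real.exp (-c * b) = Real.exp (-c * (b - a)) * Real.exp (-c * a) := by
        rw [← Real.exp_add]; ring_nf
      have e₂ : Real.exp (c * τ b j) = Real.exp (-c * (b - a)) * Real.exp (c * τ a j) := by
        rw [← Real.exp_add, hτ.flow j a b hab hI]; ring_nf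
      have decay := mul_le_mul_of_nonneg_left ha (Real.exp_pos (-c * (b - a))).le
      rw [e₁, e₂]
      linarith [hflow j a b hab hI]
    · intro p hp hQ
      rw [hτ.eq_zero p hp, mul_zero, Real.exp_zero, mul_one] at hQ
      have reset : B * Real.exp (c * T₁) ≤ B * Real.exp (c * τ p.1 (p.2 + 1)) := by
        gcongr
        exact hτ.le_reset p hp
      linarith [hjump p hp]
  rw [← add_assoc]
  refine (invariant p hp).trans ?_
  gcongr
  exact (hτ.mem_Icc p hp).2

end IsTimer

/-! ### Quadratic forms -/

section QuadForm

variable {n : ℕ} {P : Matrix (Fin n) (Fin n) ℝ}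

/-- The action of a matrix on Euclidean vectors, as a continuous linear map. -/
def appL {m n : ℕ} (M : Matrix (Fin m) (Fin n) ℝ) : E n →L[ℝ] E m :=
  LinearMap.toContinuousLinearMap (Matrix.toEuclideanLin M)

/-- The quadratic form `v ↦ vᵀ P v` on Euclidean vectors. -/
def quadForm (P : Matrix (Fin n) (Fin n) ℝ) (v : E n) : ℝ := inner ℝ v (app P v)

theorem inner_eq_dotProduct (v w : E n) : inner ℝ v w = v.ofLp ⬝ᵥ w.ofLp := by
  rw [EuclideanSpace.inner_eq_star_dotProduct, star_trivial, dotProduct_comm]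

theorem norm_sq_eq_dotProduct (v : E n) : ‖v‖ ^ 2 = v.ofLp ⬝ᵥ v.ofLp := by
  rw [← real_inner_self_eq_norm_sq, inner_eq_dotProduct]

theorem quadForm_eq_dotProduct (P : Matrix (Fin n) (Fin n) ℝ) (v : E n) :
    quadForm P v = v.ofLp ⬝ᵥ P *ᵥ v.ofLp :=
  inner_eq_dotProduct v (app P v)

theorem quadForm_neg (P : Matrix (Fin n) (Fin n) ℝ) (v : E n) :
    quadForm P (-v) = quadForm P v := by
  rw [quadForm, quadForm, app, map_neg, inner_neg_neg]

theorem quadForm_smul (P : Matrix (Fin n) (Fin n) ℝ) (r : ℝ) (v : E n) :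
    quadForm P (r • v) = r ^ 2 * quadForm P v := by
  rw [quadForm, quadForm, app, map_smul, real_inner_smul_left, real_inner_smul_right]
  ring

theorem quadForm_nonneg (hP : P.PosSemidef) (v : E n) : 0 ≤ quadForm P v := by
  simpa [quadForm_eq_dotProduct] using hP.dotProduct_mulVec_nonneg v.ofLp

theorem quadForm_pos (hP : P.PosDef) {v : E n} (hv : v ≠ 0) : 0 < quadForm P v := by
  simpa [quadForm_eq_dotProduct] using
    hP.dotProduct_mulVec_pos (x := v.ofLp) (by simpa using hv)

theorem contDiff_quadForm (P : Matrix (Fin n) (Fin n) ℝ) : ContDiff ℝ 1 (quadForm P) :=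
  contDiff_id.inner ℝ (appL P).contDiff

theorem hasDerivAt_quadForm (hP : P.IsHermitian) {v : ℝ → E n} {v' : E n} {t : ℝ}
    (hv : HasDerivAt v v' t) :
    HasDerivAt (fun s => quadForm P (v s)) (2 * inner ℝ v' (app P (v t))) t := by
  have happ : HasDerivAt (fun s => app P (v s)) (app P v') t :=
    (appL P).hasFDerivAt.comp_hasDerivAt t hv
  have hsymm : inner ℝ (v t) (app P v') = inner ℝ v' (app P (v t)) := by
    rw [real_inner_comm]
    exact Matrix.isSymmetric_toEuclideanLin_iff.2 hP v' (v t)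
  refine (hv.inner ℝ happ).congr_deriv ?_
  rw [hsymm, two_mul]

theorem exists_mul_norm_sq_le_quadForm (hP : P.PosDef) :
    ∃ c > 0, ∀ v : E n, c * ‖v‖ ^ 2 ≤ quadForm P v := by
  rcases subsingleton_or_nontrivial (E n) with _ | _
  · exact ⟨1, one_pos, fun v => by simp [Subsingleton.elim v 0, quadForm]⟩
  obtain ⟨v, hv, hmin⟩ := (isCompact_sphere (0 : E n) 1).exists_isMinOn
    (NormedSpace.sphere_nonempty.2 zero_le_one) (contDiff_quadForm P).continuous.continuousOn
  refine ⟨quadForm P v, quadForm_pos hP (ne_zero_of_mem_unit_sphere ⟨v, hv⟩), fun x => ?_⟩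
  rcases eq_or_ne x 0 with rfl | hx
  · simp [quadForm]
  have hx' : 0 < ‖x‖ := norm_pos_iff.2 hx
  have hle : quadForm P v ≤ quadForm P (‖x‖⁻¹ • x) := hmin (by simp [norm_smul, hx'.ne'])
  rwa [quadForm_smul, inv_pow, inv_mul_eq_div, le_div_iff₀ (by positivity)] at hle

theorem exists_quadForm_le_mul_norm_sq (P : Matrix (Fin n) (Fin n) ℝ) :
    ∃ c > 0, ∀ v : E n, quadForm P v ≤ c * ‖v‖ ^ 2 := by
  refine ⟨‖appL P‖ + 1, by positivity, fun v => ?_⟩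
  calc quadForm P v ≤ ‖v‖ * ‖app P v‖ := real_inner_le_norm _ _
    _ ≤ ‖v‖ * (‖appL P‖ * ‖v‖) := by gcongr; exact (appL P).le_opNorm v
    _ = ‖appL P‖ * ‖v‖ ^ 2 := by ring
    _ ≤ (‖appL P‖ + 1) * ‖v‖ ^ 2 := by gcongr; linarith

end QuadForm

/-! ### The matrix inequalities -/

section NegDef

variable {ι : Type*} [Fintype ι] {M : Matrix ι ι ℝ}

theorem NegDef.dotProduct_mulVec_neg (h : NegDef M) {v : ι → ℝ} (hv : v ≠ 0) :
    v ⬝ᵥ (M *ᵥ v) < 0 := by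
  simpa [Matrix.neg_mulVec] using Matrix.PosDef.dotProduct_mulVec_pos h hv

theorem NegDef.dotProduct_mulVec_nonpos (h : NegDef M) (v : ι → ℝ) : v ⬝ᵥ (M *ᵥ v) ≤ 0 := by
  simpa [Matrix.neg_mulVec] using Matrix.PosSemidef.dotProduct_mulVec_nonneg h.posSemidef v

end NegDef

section LMI

open Matrix

variable {nz ny nw nq ns np : ℕ}

/-- The vector with blocks `(a, b)`, `(c, d)` and `(w, ζ)`, arranged as in `lmiMatrix`. Along the
flow `c = z - ẑ` and `d = C c - θ`, `a` and `b` are their derivatives, `w` is the disturbance and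
`ζ = ψ (S z) - ψ (S ẑ)`. -/
def lmiVec (a : Fin nz → ℝ) (b : Fin ny → ℝ) (c : Fin nz → ℝ) (d : Fin ny → ℝ) (w : Fin nw → ℝ)
    (ζ : Fin ns → ℝ) : ((Fin nz ⊕ Fin ny) ⊕ (Fin nz ⊕ Fin ny)) ⊕ (Fin nw ⊕ Fin ns) → ℝ :=
  Sum.elim (Sum.elim (Sum.elim a b) (Sum.elim c d)) (Sum.elim w ζ)

section

variable (pl : Plant nz ny nw nq ns np) (lam γ δ χ e : ℝ)
  (P₁ : Matrix (Fin nz) (Fin nz) ℝ) (P₂ : Matrix (Fin ny) (Fin ny) ℝ)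
  (X : Matrix (Fin nz) (Fin nz) ℝ) (U W : Matrix (Fin ny) (Fin ny) ℝ)
  (J : Matrix (Fin nz) (Fin ny) ℝ)

theorem lmiVec_dotProduct_lmiMatrix_mulVec (a c : Fin nz → ℝ) (b d : Fin ny → ℝ) (w : Fin nw → ℝ)
    (ζ : Fin ns → ℝ) :
    lmiVec a b c d w ζ ⬝ᵥ (lmiMatrix pl lam γ δ χ e P₁ P₂ X U W J *ᵥ lmiVec a b c d w ζ) =
    2 * (a ⬝ᵥ (P₁ *ᵥ c)) + 2 * e * (b ⬝ᵥ (P₂ *ᵥ d)) + 2 * lam * (c ⬝ᵥ (P₁ *ᵥ c))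
      + (pl.Cp *ᵥ c) ⬝ᵥ (pl.Cp *ᵥ c) + χ * pl.ℓ ^ 2 * ((pl.S *ᵥ c) ⬝ᵥ (pl.S *ᵥ c))
      + (2 * lam - δ) * e * (d ⬝ᵥ (P₂ *ᵥ d)) - γ ^ 2 * (w ⬝ᵥ w) - χ * (ζ ⬝ᵥ ζ)
      + 2 * ((pl.A *ᵥ c + pl.B *ᵥ ζ + pl.N *ᵥ w - a) ⬝ᵥ (X *ᵥ (a + c))
        + (a + c) ⬝ᵥ (J *ᵥ (d - pl.C *ᵥ c)))
      + 2 * ((pl.C *ᵥ a - b) ⬝ᵥ (U *ᵥ (b + d)) + (b + d) ⬝ᵥ (W *ᵥ (d - pl.C *ᵥ c))) := by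
  simp only [lmiVec, lmiMatrix, He, fromBlocks_mulVec, Sum.elim_comp_inl, Sum.elim_comp_inr,
    fromBlocks_transpose, transpose_fromRows, fromRows_mulVec, fromCols_mulVec,
    sumElim_dotProduct_sumElim, add_mulVec, transpose_add, transpose_mul, transpose_neg,
    transpose_sub, transpose_transpose, transpose_smul, transpose_zero, neg_mulVec,
    sub_mulVec, smul_mulVec, zero_mulVec, one_mulVec, ← mulVec_mulVec, dotProduct_add,
    dotProduct_sub, dotProduct_neg, dotProduct_smul, mulVec_add, mulVec_sub,
    add_dotProduct, sub_dotProduct,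
    dotProduct_transpose_mulVec, smul_eq_mul, add_zero, zero_add, ← Sum.elim_add_add]
  simp only [dotProduct_comm (X *ᵥ a) (pl.A *ᵥ c), dotProduct_comm (X *ᵥ c) (pl.A *ᵥ c),
    dotProduct_comm (X *ᵥ a) (pl.N *ᵥ w), dotProduct_comm (X *ᵥ c) (pl.N *ᵥ w),
    dotProduct_comm (X *ᵥ a) (pl.B *ᵥ ζ), dotProduct_comm (X *ᵥ c) (pl.B *ᵥ ζ),
    dotProduct_comm (pl.C *ᵥ a) (U *ᵥ b), dotProduct_comm (pl.C *ᵥ a) (U *ᵥ d),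
    dotProduct_comm (Jᵀ *ᵥ a) (pl.C *ᵥ c), dotProduct_comm (Jᵀ *ᵥ c) (pl.C *ᵥ c),
    dotProduct_comm (Wᵀ *ᵥ b) (pl.C *ᵥ c), dotProduct_comm (Wᵀ *ᵥ d) (pl.C *ᵥ c),
    dotProduct_transpose_mulVec]
  ring

end

theorem mulVec_dotProduct_mulVec_add_mulVec_neg {m n : ℕ} (X : Matrix (Fin n) (Fin n) ℝ)
    (L : Matrix (Fin n) (Fin m) ℝ) (v : Fin n → ℝ) (θ : Fin m → ℝ) :
    (L *ᵥ θ) ⬝ᵥ (X *ᵥ v) + v ⬝ᵥ ((Xᵀ * L) *ᵥ -θ) = 0 := by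
  rw [mulVec_neg, dotProduct_neg, ← mulVec_mulVec, dotProduct_transpose_mulVec, add_neg_cancel]

namespace LMIsFeasibleAt

variable {pl : Plant nz ny nw nq ns np} {T₂ lam γ δ χ : ℝ}
  {P₁ : Matrix (Fin nz) (Fin nz) ℝ} {P₂ : Matrix (Fin ny) (Fin ny) ℝ}
  {X : Matrix (Fin nz) (Fin nz) ℝ} {U W : Matrix (Fin ny) (Fin ny) ℝ}
  {J : Matrix (Fin nz) (Fin ny) ℝ}

theorem isUnit_det_X (h : LMIsFeasibleAt pl T₂ lam γ δ χ P₁ P₂ X U W J) : IsUnit X.det := by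
  by_contra hdet
  obtain ⟨v, hv, hXv⟩ := exists_mulVec_eq_zero_iff.2 (by simpa using hdet)
  have hneg := h.lmi_zero.dotProduct_mulVec_neg (v := lmiVec v 0 0 0 0 0) fun h0 =>
    hv (funext fun i => congrFun h0 (Sum.inl (Sum.inl (Sum.inl i))))
  rw [lmiVec_dotProduct_lmiMatrix_mulVec] at hneg
  simp [hXv] at hneg

theorem isUnit_det_U (h : LMIsFeasibleAt pl T₂ lam γ δ χ P₁ P₂ X U W J) : IsUnit U.det := by
  by_contra hdet
  obtain ⟨v, hv, hUv⟩ := exists_mulVec_eq_zero_iff.2 (by simpa using hdet)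
  have hneg := h.lmi_zero.dotProduct_mulVec_neg (v := lmiVec 0 v 0 0 0 0) fun h0 =>
    hv (funext fun i => congrFun h0 (Sum.inl (Sum.inl (Sum.inr i))))
  rw [lmiVec_dotProduct_lmiMatrix_mulVec] at hneg
  simp [hUv] at hneg

/-- The quadratic form is affine in `e`. -/
theorem lmiVec_dotProduct_lmiMatrix_mulVec_nonpos
    (h : LMIsFeasibleAt pl T₂ lam γ δ χ P₁ P₂ X U W J) {e : ℝ}
    (he : e ∈ Icc 1 (Real.exp (δ * T₂))) (a c : Fin nz → ℝ) (b d : Fin ny → ℝ)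
    (w : Fin nw → ℝ) (ζ : Fin ns → ℝ) :
    lmiVec a b c d w ζ ⬝ᵥ (lmiMatrix pl lam γ δ χ e P₁ P₂ X U W J *ᵥ lmiVec a b c d w ζ) ≤ 0 := by
  have h₀ := h.lmi_zero.dotProduct_mulVec_nonpos (lmiVec a b c d w ζ)
  have h₁ := h.lmi_T₂.dotProduct_mulVec_nonpos (lmiVec a b c d w ζ)
  rw [← segment_eq_Icc (he.1.trans he.2)] at he
  obtain ⟨r, s, hr, hs, hrs, rfl⟩ := he
  rw [lmiVec_dotProduct_lmiMatrix_mulVec] at h₀ h₁ ⊢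
  obtain rfl : r = 1 - s := by linarith
  simp only [smul_eq_mul]
  linarith [mul_nonpos_of_nonneg_of_nonpos hr h₀, mul_nonpos_of_nonneg_of_nonpos hs h₁]

end LMIsFeasibleAt

/-- The dissipation inequality for the error dynamics with observer gains `L`, `H`, in terms of the
error `ε`, the injection error `C ε - θ`, and the increment `ζ` of the nonlinearity. Here `e`
stands for `e^{δ τ}`, and the left-hand side is the derivative of
`εᵀ P₁ ε + e^{δ τ} (C ε - θ)ᵀ P₂ (C ε - θ)` along the flow. -/
structure IsDissipative (pl : Plant nz ny nw nq ns np) (T₂ lam γ δ : ℝ)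
    (P₁ : Matrix (Fin nz) (Fin nz) ℝ) (P₂ : Matrix (Fin ny) (Fin ny) ℝ)
    (L : Matrix (Fin nz) (Fin ny) ℝ) (H : Matrix (Fin ny) (Fin ny) ℝ) : Prop where
  P₁_pos : P₁.PosDef
  P₂_pos : P₂.PosDef
  δ_pos : 0 < δ
  le : ∀ e ∈ Icc 1 (Real.exp (δ * T₂)), ∀ (ε : E nz) (θ : E ny) (w : E nw) (ζ : E ns),
    ‖ζ‖ ≤ pl.ℓ * ‖app pl.S ε‖ → ∀ ε', ε' = app pl.A ε + app pl.B ζ + app pl.N w - app L θ →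
    2 * inner ℝ ε' (app P₁ ε)
        + (-δ * e * quadForm P₂ (app pl.C ε - θ)
          + e * (2 * inner ℝ (app pl.C ε' - app H θ) (app P₂ (app pl.C ε - θ)))) ≤
      -(2 * lam) * (quadForm P₁ ε + e * quadForm P₂ (app pl.C ε - θ))
        - ‖app pl.Cp ε‖ ^ 2 + γ ^ 2 * ‖w‖ ^ 2

/-- The gains are chosen such that the terms with the free matrices `X` and `U` vanish along the
flow, where they are multiplied by the dynamics. -/
theorem LMIsFeasibleAt.isDissipative {pl : Plant nz ny nw nq ns np} {T₂ lam γ δ χ : ℝ}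
    {P₁ : Matrix (Fin nz) (Fin nz) ℝ} {P₂ : Matrix (Fin ny) (Fin ny) ℝ}
    {X : Matrix (Fin nz) (Fin nz) ℝ} {U W : Matrix (Fin ny) (Fin ny) ℝ}
    {J : Matrix (Fin nz) (Fin ny) ℝ} (h : LMIsFeasibleAt pl T₂ lam γ δ χ P₁ P₂ X U W J) :
    IsDissipative pl T₂ lam γ δ P₁ P₂ ((Xᵀ)⁻¹ * J) ((Uᵀ)⁻¹ * W) where
  P₁_pos := h.P₁_pos
  P₂_pos := h.P₂_pos
  δ_pos := h.δ_pos
  le := by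
    intro e he ε θ w ζ hζ ε' hε'
    set L := (Xᵀ)⁻¹ * J with hL
    set H := (Uᵀ)⁻¹ * W with hH
    set b := app pl.C ε' - app H θ with hb
    set d := app pl.C ε - θ with hd
    have hJ : J = Xᵀ * L := by
      rw [hL, mul_nonsing_inv_cancel_left _ _ (by simpa using h.isUnit_det_X)]
    have hW : W = Uᵀ * H := by
      rw [hH, mul_nonsing_inv_cancel_left _ _ (by simpa using h.isUnit_det_U)]
    have lmi := h.lmiVec_dotProduct_lmiMatrix_mulVec_nonpos he ε'.ofLp ε.ofLp b.ofLp d.ofLp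
      w.ofLp ζ.ofLp
    have hεθ : pl.A *ᵥ ε.ofLp + pl.B *ᵥ ζ.ofLp + pl.N *ᵥ w.ofLp - ε'.ofLp = L *ᵥ θ.ofLp := by
      simp [hε']
    have hbθ : pl.C *ᵥ ε'.ofLp - b.ofLp = H *ᵥ θ.ofLp := by simp [hb]
    have hdθ : d.ofLp - pl.C *ᵥ ε.ofLp = -θ.ofLp := by simp [hd]
    rw [lmiVec_dotProduct_lmiMatrix_mulVec, hεθ, hbθ, hdθ, hJ, hW,
      mulVec_dotProduct_mulVec_add_mulVec_neg, mulVec_dotProduct_mulVec_add_mulVec_neg] at lmi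
    have lipschitz : χ * ‖ζ‖ ^ 2 ≤ χ * (pl.ℓ * ‖app pl.S ε‖) ^ 2 :=
      mul_le_mul_of_nonneg_left (pow_le_pow_left₀ (norm_nonneg _) hζ 2) h.χ_pos.le
    simp only [mul_pow, norm_sq_eq_dotProduct, inner_eq_dotProduct, quadForm_eq_dotProduct,
      Matrix.ofLp_toLpLin, Matrix.toLin'_apply] at lipschitz ⊢
    linarith

end LMI

/-! ### The closed loop -/

theorem exists_hasDerivWithinAt_of_lipschitzWith {F : Type*} [NormedAddCommGroup F]
    [NormedSpace ℝ F] [CompleteSpace F] {K : ℝ≥0} {f : F → F} (hf : LipschitzWith K f) (x : F)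
    {b : ℝ} (hb : 0 < b) :
    ∃ h, 0 < h ∧ h ≤ b ∧ ∃ ξ : ℝ → F, ξ 0 = x ∧
      ∀ t ∈ Icc 0 h, HasDerivWithinAt ξ (f (ξ t)) (Icc 0 h) t := by
  set M : ℝ≥0 := K + ‖f x‖₊ with hM
  obtain ⟨h, hh, hhb, hMh⟩ : ∃ h : ℝ, 0 < h ∧ h ≤ b ∧ M * h ≤ 1 := by
    refine ⟨min b (1 / (M + 1)), lt_min hb (by positivity), min_le_left _ _,
      (mul_le_mul_of_nonneg_left (min_le_right _ _) M.2).trans ?_⟩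
    rw [mul_one_div, div_le_one (by positivity)]
    exact (lt_add_one _).le
  have picard : IsPicardLindelof (fun _ => f) (tmin := 0) (tmax := h) ⟨0, le_rfl, hh.le⟩
      x 1 0 M K :=
    { lipschitzOnWith := fun t _ => hf.lipschitzOnWith
      continuousOn := fun y _ => continuousOn_const
      norm_le := fun t _ y hy => by
        have hy' : ‖y - x‖ ≤ 1 := by simpa [dist_eq_norm] using hy
        calc ‖f y‖ ≤ ‖f x‖ + ‖f y - f x‖ := norm_le_norm_add_norm_sub' _ _
          _ ≤ ‖f x‖ + K * ‖y - x‖ := add_le_add_right (hf.norm_sub_le y x) _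
          _ ≤ M := by
            have hK : (K : ℝ) * ‖y - x‖ ≤ K := mul_le_of_le_one_right K.2 hy'
            rw [hM, NNReal.coe_add, coe_nnnorm]
            linarith
      mul_max_le := by simpa [hh.le] using hMh }
  obtain ⟨ξ, hξ₀, hξ⟩ := picard.exists_eq_forall_mem_Icc_hasDerivWithinAt₀
  exact ⟨h, hh, hhb, ξ, hξ₀, hξ⟩

theorem absolutelyContinuousOnInterval_of_hasDerivWithinAt {F : Type*} [NormedAddCommGroup F]
    [NormedSpace ℝ F] {a b : ℝ} {ξ ξ' : ℝ → F} (hab : a ≤ b)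
    (hξ : ∀ t ∈ Icc a b, HasDerivWithinAt ξ (ξ' t) (Icc a b) t) (hξ' : ContinuousOn ξ' (Icc a b)) :
    AbsolutelyContinuousOnInterval ξ a b := by
  obtain ⟨C, hC⟩ := isCompact_Icc.exists_bound_of_continuousOn hξ'
  have hlip : LipschitzOnWith C.toNNReal ξ (Icc a b) :=
    (convex_Icc a b).lipschitzOnWith_of_nnnorm_hasDerivWithin_le hξ fun t ht => by
      rw [← NNReal.coe_le_coe, coe_nnnorm]
      exact (hC t ht).trans (Real.le_coe_toNNReal C)
  rw [← uIcc_of_le hab] at hlip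
  exact hlip.absolutelyContinuousOnInterval

theorem exists_flow_of_timer {X W V : Type*} [NormedAddCommGroup X] [NormedSpace ℝ X]
    [CompleteSpace X] [NormedAddCommGroup W] (S : HybridSystem X W V) {K : ℝ≥0} {T : ℝ}
    (hlip : LipschitzWith K fun y => S.flowMap y 0) (timer : X →L[ℝ] ℝ)
    (htimer : ∀ y, timer (S.flowMap y 0) = -1) (hS : {y | timer y ∈ Icc 0 T} ⊆ S.flowSet) {x : X}
    (hx : timer x ∈ Ioc 0 T) :
    ∃ b > 0, ∃ ξ : ℝ → X, ξ 0 = x ∧ AbsolutelyContinuousOnInterval ξ 0 b ∧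
      ∀ s ∈ Ioo 0 b, HasDerivAt ξ (S.flowMap (ξ s) 0) s ∧ ξ s ∈ S.flowSet := by
  obtain ⟨b, hb, hbx, ξ, rfl, hξ⟩ := exists_hasDerivWithinAt_of_lipschitzWith hlip x hx.1
  have hac := absolutelyContinuousOnInterval_of_hasDerivWithinAt hb.le hξ
    (hlip.continuous.comp_continuousOn fun t ht => (hξ t ht).continuousWithinAt)
  have hder : ∀ s ∈ Ioo 0 b, HasDerivAt ξ (S.flowMap (ξ s) 0) s :=
    fun s hs => (hξ s (Ioo_subset_Icc_self hs)).hasDerivAt (Icc_mem_nhds hs.1 hs.2)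
  refine ⟨b, hb, ξ, rfl, hac, fun s hs => ⟨hder s hs, hS ?_⟩⟩
  have hτ : timer (ξ s) = timer (ξ 0) + (-1) * (s - 0) :=
    eq_add_mul_of_ae_hasDerivAt hs.1.le
      (absolutelyContinuousOnInterval_comp_lipschitzOnWith (s := univ)
        timer.lipschitz.lipschitzOnWith
        (hac.mono (uIcc_subset_uIcc_left (by grind [mem_uIcc]))) (mapsTo_univ _ _))
      (.of_forall fun t ht => htimer (ξ t) ▸ timer.hasFDerivAt.comp_hasDerivAt t
        (hder t ⟨ht.1, ht.2.trans hs.2⟩))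
  exact ⟨by linarith [hs.2], by linarith [hs.1, hx.2]⟩

namespace State

variable {nz ny : ℕ}

/-- The plant state, as a continuous linear map. -/
def zL : State nz ny →L[ℝ] E nz := WithLp.fstL 2 ℝ _ _

/-- The estimate of the plant state, as a continuous linear map. -/
def zhatL : State nz ny →L[ℝ] E nz := (WithLp.fstL 2 ℝ _ _).comp (WithLp.sndL 2 ℝ _ _)

/-- The injection variable, as a continuous linear map. -/
def θL : State nz ny →L[ℝ] E ny :=
  (WithLp.fstL 2 ℝ _ _).comp ((WithLp.sndL 2 ℝ _ _).comp (WithLp.sndL 2 ℝ _ _))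

/-- The timer, as a continuous linear map. -/
def τL : State nz ny →L[ℝ] ℝ :=
  (WithLp.sndL 2 ℝ _ _).comp ((WithLp.sndL 2 ℝ _ _).comp (WithLp.sndL 2 ℝ _ _))

/-- The estimation error, as a continuous linear map. -/
def εL : State nz ny →L[ℝ] E nz := zL - zhatL

variable (a b : E nz) (c : E ny) (d : ℝ)

@[simp] theorem mk_θ : (mk a b c d).θ = c := rfl
@[simp] theorem mk_ε : (mk a b c d).ε = a - b := rfl

theorem norm_sq_eq (x : State nz ny) :
    ‖x‖ ^ 2 = ‖x.z‖ ^ 2 + ‖x.zhat‖ ^ 2 + ‖x.θ‖ ^ 2 + x.τ ^ 2 := by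
  rw [WithLp.prod_norm_sq_eq_of_L2, WithLp.prod_norm_sq_eq_of_L2, WithLp.prod_norm_sq_eq_of_L2,
    Real.norm_eq_abs, sq_abs]
  simp only [z, zhat, θ, τ, add_assoc]

end State

section Target

variable {nz ny : ℕ} {T₂ : ℝ} {x : State nz ny}

theorem infDist_target_sq_le (hx : x.τ ∈ Icc 0 T₂) :
    Metric.infDist x (target nz ny T₂) ^ 2 ≤ ‖x.ε‖ ^ 2 + ‖x.θ‖ ^ 2 := by
  have hdist := Metric.infDist_le_dist_of_mem (x := x) (s := target nz ny T₂)
    (y := State.mk x.z x.z 0 x.τ) ⟨rfl, rfl, hx⟩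
  refine (pow_le_pow_left₀ Metric.infDist_nonneg hdist 2).trans_eq ?_
  have hz : (x - State.mk x.z x.z 0 x.τ).z = 0 := sub_self x.z
  have hzhat : (x - State.mk x.z x.z 0 x.τ).zhat = x.zhat - x.z := rfl
  have hθ : (x - State.mk x.z x.z 0 x.τ).θ = x.θ := sub_zero x.θ
  have hτ : (x - State.mk x.z x.z 0 x.τ).τ = 0 := sub_self x.τ
  rw [dist_eq_norm, State.norm_sq_eq, hz, hzhat, hθ, hτ, norm_sub_rev, State.ε]
  simp

theorem le_infDist_target_sq (hT₂ : 0 ≤ T₂) (x : State nz ny) :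
    ‖x.ε‖ ^ 2 / 2 + ‖x.θ‖ ^ 2 ≤ Metric.infDist x (target nz ny T₂) ^ 2 := by
  rw [← Real.sqrt_le_left Metric.infDist_nonneg]
  have hne : (target nz ny T₂).Nonempty := ⟨State.mk 0 0 0 0, rfl, rfl, le_rfl, hT₂⟩
  refine (Metric.le_infDist hne).2 fun {y} hy => ?_
  have hz : (x - y).z = x.z - y.z := rfl
  have hzhat : (x - y).zhat = x.zhat - y.z := by rw [hy.1]; rfl
  have hθ : (x - y).θ = x.θ := by rw [show (x - y).θ = x.θ - y.θ from rfl, hy.2.1, sub_zero]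
  have hε : x.ε = (x.z - y.z) - (x.zhat - y.z) := by rw [State.ε]; abel
  rw [Real.sqrt_le_left dist_nonneg, dist_eq_norm, State.norm_sq_eq, hz, hzhat, hθ, hε]
  have hle := pow_le_pow_left₀ (norm_nonneg _) (norm_sub_le (x.z - y.z) (x.zhat - y.z)) 2
  linarith [sq_nonneg (‖x.z - y.z‖ - ‖x.zhat - y.z‖), sq_nonneg (x - y).τ,
    add_sq_le (a := ‖x.z - y.z‖) (b := ‖x.zhat - y.z‖)]

end Target

section Viability

variable {nz ny nw nq ns np : ℕ} (pl : Plant nz ny nw nq ns np) {T₁ T₂ : ℝ}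
  (L : Matrix (Fin nz) (Fin ny) ℝ) (H : Matrix (Fin ny) (Fin ny) ℝ)

theorem Plant.lipschitzWith_ψ : LipschitzWith pl.ℓ.toNNReal pl.ψ :=
  LipschitzWith.of_dist_le_mul fun x y => by
    rw [dist_eq_norm, dist_eq_norm, Real.coe_toNNReal _ pl.ℓ_pos.le]
    exact pl.lipschitz x y

theorem exists_lipschitzWith_flowMap (T₁ T₂ : ℝ) : ∃ K, LipschitzWith K
    fun p : State nz ny × E nw => (closedLoop pl T₁ T₂ L H).flowMap p.1 p.2 := by
  have hdrift := (appL pl.A).lipschitz.add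
    ((appL pl.B).lipschitz.comp (pl.lipschitzWith_ψ.comp (appL pl.S).lipschitz))
  have hfst := LipschitzWith.prod_fst (α := State nz ny) (β := E nw)
  have hz := (hdrift.comp (State.zL.lipschitz.comp hfst)).add
    ((appL pl.N).lipschitz.comp LipschitzWith.prod_snd)
  have hzhat := (hdrift.comp (State.zhatL.lipschitz.comp hfst)).add
    ((appL L).lipschitz.comp (State.θL.lipschitz.comp hfst))
  have hθ := (appL H).lipschitz.comp (State.θL.lipschitz.comp hfst)
  exact ⟨_, (WithLp.prod_lipschitzWith_toLp 2 _ _).comp <| hz.prodMk <|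
    (WithLp.prod_lipschitzWith_toLp 2 _ _).comp <| hzhat.prodMk <|
      (WithLp.prod_lipschitzWith_toLp 2 _ _).comp <| hθ.prodMk <| LipschitzWith.const (-1 : ℝ)⟩

theorem isViable_closedLoop (hT₁ : 0 ≤ T₁) (hT : T₁ ≤ T₂) : IsViable (closedLoop pl T₁ T₂ L H) where
  isClosed := isClosed_Icc.preimage State.τL.continuous
  growth := by
    obtain ⟨K, hK⟩ := exists_lipschitzWith_flowMap pl L H T₁ T₂
    set f := (closedLoop pl T₁ T₂ L H).flowMap
    refine ⟨K + ‖f 0 0‖, by positivity, fun x w => ?_⟩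
    calc ‖f x w‖ ≤ ‖f 0 0‖ + ‖f x w - f 0 0‖ := norm_le_norm_add_norm_sub' _ _
      _ ≤ ‖f 0 0‖ + K * ‖(x, w)‖ := by
        gcongr
        simpa using hK.norm_sub_le (x, w) (0, 0)
      _ ≤ ‖f 0 0‖ + K * (‖x‖ + ‖w‖) := by
        gcongr
        exact max_le_add_of_nonneg (norm_nonneg _) (norm_nonneg _)
      _ ≤ (K + ‖f 0 0‖) * (‖x‖ + ‖w‖ + 1) := by
        have : 0 ≤ ‖f 0 0‖ * (‖x‖ + ‖w‖) := by positivity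
        linarith [K.2]
  jumpSet_subset := fun x (hx : x.τ = 0) => ⟨hx.ge, hx.le.trans (hT₁.trans hT)⟩
  jumpMap_subset := by
    rintro x - η g ⟨v, hv, rfl⟩
    exact ⟨hT₁.trans hv.1, hv.2⟩
  jump_or_flow := fun x hx => by
    rcases hx.1.eq_or_lt with h0 | hpos
    · exact .inl ⟨h0.symm, fun η => ⟨_, T₁, ⟨le_rfl, hT⟩, rfl⟩⟩
    · obtain ⟨K, hK⟩ := exists_lipschitzWith_flowMap pl L H T₁ T₂
      exact .inr (exists_flow_of_timer _ (hK.comp (LipschitzWith.prodMk_right 0)) State.τL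
        (fun _ => rfl) subset_rfl ⟨hpos, hx.2⟩)

end Viability

/-! ### Solutions of the closed loop -/

section Observables

variable {X W V F : Type*} [NormedAddCommGroup X] [NormedSpace ℝ X] [NormedAddCommGroup W]
  [NormedAddCommGroup V] [NormedAddCommGroup F] [NormedSpace ℝ F] {S : HybridSystem X W V}
  {D : Set (ℝ × ℕ)} {φ : ℝ → ℕ → X} {u : ℝ → ℕ → WithLp 2 (W × V)} {j : ℕ} {a b : ℝ}

theorem IsHybridArc.clm_comp (h : IsHybridArc D φ) (Q : X →L[ℝ] F) :
    IsHybridArc D fun t j => Q (φ t j) := fun j a b hab hI =>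
  absolutelyContinuousOnInterval_comp_lipschitzOnWith (s := univ) Q.lipschitz.lipschitzOnWith
    (h j a b hab hI) fun _ _ => mem_univ _

theorem IsSolutionPair.ae_hasDerivAt_clm (hs : IsSolutionPair S D φ u) (Q : X →L[ℝ] F)
    (hI : Icc a b ⊆ slice D j) :
    ∀ᵐ t, t ∈ Ioo a b →
      HasDerivAt (fun s => Q (φ s j)) (Q (S.flowMap (φ t j) (u t j).fst)) t := by
  filter_upwards [hs.ae_hasDerivAt j] with t ht hmem
  exact Q.hasFDerivAt.comp_hasDerivAt t
    (ht (interior_maximal (Ioo_subset_Icc_self.trans hI) isOpen_Ioo hmem))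

end Observables

section ClosedLoop

variable {nz ny nw nq ns np : ℕ} {pl : Plant nz ny nw nq ns np} {T₁ T₂ lam γ δ : ℝ}
  {P₁ : Matrix (Fin nz) (Fin nz) ℝ} {P₂ : Matrix (Fin ny) (Fin ny) ℝ}
  {L : Matrix (Fin nz) (Fin ny) ℝ} {H : Matrix (Fin ny) (Fin ny) ℝ} {D : Set (ℝ × ℕ)}
  {φ : ℝ → ℕ → State nz ny} {u : ℝ → ℕ → WithLp 2 (E nw × E ny)} {j : ℕ} {a b : ℝ}

theorem isTimer_closedLoop (hs : IsSolutionPair (closedLoop pl T₁ T₂ L H) D φ u) (hT₁ : 0 ≤ T₁)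
    (hT : T₁ ≤ T₂) : IsTimer D T₁ T₂ fun t j => (φ t j).τ where
  domain := hs.domain
  mem_Icc :=
    have h := isViable_closedLoop pl L H hT₁ hT
    hs.mem_flowSet h.isClosed h.jumpSet_subset h.jumpMap_subset
  flow j a b hab hI := by
    have h := eq_add_mul_of_ae_hasDerivAt (c := -1) hab (hs.arc.clm_comp State.τL j a b hab hI)
      (hs.ae_hasDerivAt_clm State.τL hI)
    exact h.trans (by rw [neg_one_mul, ← sub_eq_add_neg]; rfl)
  eq_zero p hp := (hs.jump p hp).1
  le_reset p hp := by
    obtain ⟨-, v, hv, hreset⟩ := hs.jump p hp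
    rw [hreset]
    exact hv.1

/-- The output error `θ̃ = C ε - θ`, as a continuous linear map. -/
def outputErrorL (pl : Plant nz ny nw nq ns np) : State nz ny →L[ℝ] E ny :=
  (appL pl.C).comp State.εL - State.θL

theorem outputErrorL_apply (x : State nz ny) : outputErrorL pl x = app pl.C x.ε - x.θ := rfl

theorem εL_flowMap (x : State nz ny) (w : E nw) :
    State.εL ((closedLoop pl T₁ T₂ L H).flowMap x w) =
      app pl.A x.ε + app pl.B (pl.ψ (app pl.S x.z) - pl.ψ (app pl.S x.zhat)) + app pl.N w
        - app L x.θ := by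
  change (app pl.A x.z + app pl.B (pl.ψ (app pl.S x.z)) + app pl.N w) -
    (app pl.A x.zhat + app pl.B (pl.ψ (app pl.S x.zhat)) + app L x.θ) = _
  simp only [State.ε, app, map_sub]
  abel

/-! ### The Lyapunov function -/

/-- The Lyapunov function `εᵀ P₁ ε + e^{δ τ} θ̃ᵀ P₂ θ̃`. -/
def lyapunov (pl : Plant nz ny nw nq ns np) (δ : ℝ) (P₁ : Matrix (Fin nz) (Fin nz) ℝ)
    (P₂ : Matrix (Fin ny) (Fin ny) ℝ) (x : State nz ny) : ℝ :=
  quadForm P₁ x.ε + Real.exp (δ * x.τ) * quadForm P₂ (outputErrorL pl x)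

theorem isHybridArc_lyapunov (hφ : IsHybridArc D φ) :
    IsHybridArc D fun t j => lyapunov pl δ P₁ P₂ (φ t j) := fun j a b hab hI =>
  have hε := absolutelyContinuousOnInterval_comp_contDiff (contDiff_quadForm P₁)
    (hφ.clm_comp State.εL j a b hab hI)
  have hθ := absolutelyContinuousOnInterval_comp_contDiff (contDiff_quadForm P₂)
    (hφ.clm_comp (outputErrorL pl) j a b hab hI)
  have hτ := absolutelyContinuousOnInterval_comp_contDiff (q := fun r => Real.exp (δ * r))
    (by fun_prop) (hφ.clm_comp State.τL j a b hab hI)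
  hε.fun_add (hτ.fun_mul hθ)

theorem lyapunov_nonneg (hP₁ : P₁.PosSemidef) (hP₂ : P₂.PosSemidef) (x : State nz ny) :
    0 ≤ lyapunov pl δ P₁ P₂ x :=
  add_nonneg (quadForm_nonneg hP₁ _) (mul_nonneg (Real.exp_pos _).le (quadForm_nonneg hP₂ _))

theorem norm_sub_sq_le {F : Type*} [SeminormedAddCommGroup F] (v w : F) :
    ‖v - w‖ ^ 2 ≤ 2 * ‖v‖ ^ 2 + 2 * ‖w‖ ^ 2 := by
  have h := pow_le_pow_left₀ (norm_nonneg _) (norm_sub_le v w) 2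
  linarith [add_sq_le (a := ‖v‖) (b := ‖w‖)]

theorem norm_app_sq_le {m n : ℕ} (M : Matrix (Fin m) (Fin n) ℝ) (v : E n) :
    ‖app M v‖ ^ 2 ≤ ‖appL M‖ ^ 2 * ‖v‖ ^ 2 := by
  rw [← mul_pow]
  exact pow_le_pow_left₀ (norm_nonneg _) ((appL M).le_opNorm v) 2

theorem exists_mul_infDist_sq_le_lyapunov (pl : Plant nz ny nw nq ns np) (hP₁ : P₁.PosDef)
    (hP₂ : P₂.PosDef) (hδ : 0 ≤ δ) (T₂ : ℝ) :
    ∃ c > 0, ∀ x : State nz ny, x.τ ∈ Icc 0 T₂ →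
      c * Metric.infDist x (target nz ny T₂) ^ 2 ≤ lyapunov pl δ P₁ P₂ x := by
  obtain ⟨p₁, hp₁, h₁⟩ := exists_mul_norm_sq_le_quadForm hP₁
  obtain ⟨p₂, hp₂, h₂⟩ := exists_mul_norm_sq_le_quadForm hP₂
  set k := 1 + 2 * ‖appL pl.C‖ ^ 2 with hk
  have hk0 : 0 < k := by positivity
  set c := min (p₁ / k) (p₂ / 2)
  have hc : 0 < c := lt_min (by positivity) (by positivity)
  refine ⟨c, hc, fun x hx => ?_⟩
  set θ' := outputErrorL pl x with hθ'
  have hexp : 1 ≤ Real.exp (δ * x.τ) := Real.one_le_exp (mul_nonneg hδ hx.1)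
  have hθ : ‖x.θ‖ ^ 2 ≤ 2 * ‖app pl.C x.ε‖ ^ 2 + 2 * ‖θ'‖ ^ 2 := by
    have h := norm_sub_sq_le (app pl.C x.ε) θ'
    rwa [hθ', outputErrorL_apply, sub_sub_cancel] at h
  calc c * Metric.infDist x (target nz ny T₂) ^ 2
      ≤ c * (k * ‖x.ε‖ ^ 2 + 2 * ‖θ'‖ ^ 2) := by
        gcongr
        rw [hk]
        linarith [infDist_target_sq_le hx, norm_app_sq_le pl.C x.ε]
    _ = c * k * ‖x.ε‖ ^ 2 + c * 2 * ‖θ'‖ ^ 2 := by ring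
    _ ≤ p₁ * ‖x.ε‖ ^ 2 + p₂ * ‖θ'‖ ^ 2 := by
        gcongr
        · exact (le_div_iff₀ hk0).1 (min_le_left _ _)
        · exact (le_div_iff₀ two_pos).1 (min_le_right _ _)
    _ ≤ lyapunov pl δ P₁ P₂ x := add_le_add (h₁ _)
        ((h₂ _).trans (le_mul_of_one_le_left (quadForm_nonneg hP₂.posSemidef _) hexp))

theorem exists_lyapunov_le_mul_infDist_sq (pl : Plant nz ny nw nq ns np)
    (P₁ : Matrix (Fin nz) (Fin nz) ℝ) (P₂ : Matrix (Fin ny) (Fin ny) ℝ) (hδ : 0 ≤ δ)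
    (T₂ : ℝ) :
    ∃ c > 0, ∀ x : State nz ny, x.τ ∈ Icc 0 T₂ →
      lyapunov pl δ P₁ P₂ x ≤ c * Metric.infDist x (target nz ny T₂) ^ 2 := by
  obtain ⟨q₁, hq₁, h₁⟩ := exists_quadForm_le_mul_norm_sq P₁
  obtain ⟨q₂, hq₂, h₂⟩ := exists_quadForm_le_mul_norm_sq P₂
  set M := Real.exp (δ * T₂)
  set k := ‖appL pl.C‖ ^ 2
  refine ⟨2 * q₁ + 4 * M * q₂ * k + 2 * M * q₂, by positivity, fun x hx => ?_⟩
  set θ' := outputErrorL pl x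
  have hθ' : ‖θ'‖ ^ 2 ≤ 2 * (k * ‖x.ε‖ ^ 2) + 2 * ‖x.θ‖ ^ 2 := by
    linarith [norm_sub_sq_le (app pl.C x.ε) x.θ, norm_app_sq_le pl.C x.ε,
      congrArg (‖·‖ ^ 2) (outputErrorL_apply (pl := pl) x)]
  have hM : Real.exp (δ * x.τ) * quadForm P₂ θ' ≤ M * (q₂ * ‖θ'‖ ^ 2) := by
    refine (mul_le_mul_of_nonneg_left (h₂ θ') (Real.exp_pos _).le).trans ?_
    gcongr
    exact Real.exp_le_exp.2 (mul_le_mul_of_nonneg_left hx.2 hδ)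
  calc lyapunov pl δ P₁ P₂ x
      ≤ q₁ * ‖x.ε‖ ^ 2 + M * (q₂ * (2 * (k * ‖x.ε‖ ^ 2) + 2 * ‖x.θ‖ ^ 2)) :=
        add_le_add (h₁ _) (hM.trans (by gcongr))
    _ ≤ (2 * q₁ + 4 * M * q₂ * k + 2 * M * q₂) * (‖x.ε‖ ^ 2 / 2 + ‖x.θ‖ ^ 2) := by
        have : 0 ≤ (2 * q₁ + 4 * M * q₂ * k) * ‖x.θ‖ ^ 2 + M * q₂ * ‖x.ε‖ ^ 2 := by positivity
        linarith
    _ ≤ _ := by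
        gcongr
        exact le_infDist_target_sq (hx.1.trans hx.2) x

theorem ae_hasDerivAt_lyapunov_and_deriv_le (h : IsDissipative pl T₂ lam γ δ P₁ P₂ L H)
    (hs : IsSolutionPair (closedLoop pl T₁ T₂ L H) D φ u) (hτ : ∀ p ∈ D, (φ p.1 p.2).τ ∈ Icc 0 T₂)
    (hI : Icc a b ⊆ slice D j) :
    ∀ᵐ t, t ∈ Ioo a b →
      HasDerivAt (fun s => lyapunov pl δ P₁ P₂ (φ s j))
        (deriv (fun s => lyapunov pl δ P₁ P₂ (φ s j)) t) t ∧
      deriv (fun s => lyapunov pl δ P₁ P₂ (φ s j)) t ≤ -(2 * lam) * lyapunov pl δ P₁ P₂ (φ t j)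
        - ‖app pl.Cp (φ t j).ε‖ ^ 2 + γ ^ 2 * ‖(u t j).fst‖ ^ 2 := by
  filter_upwards [hs.ae_hasDerivAt_clm State.εL hI, hs.ae_hasDerivAt_clm (outputErrorL pl) hI,
    hs.ae_hasDerivAt_clm State.τL hI] with t hε hθ hτ' hmem
  set ε' := State.εL ((closedLoop pl T₁ T₂ L H).flowMap (φ t j) (u t j).fst)
  replace hε : HasDerivAt (fun s => (φ s j).ε) ε' t := hε hmem
  replace hθ : HasDerivAt (fun s => outputErrorL pl (φ s j))
    (app pl.C ε' - app H (φ t j).θ) t := hθ hmem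
  replace hτ' : HasDerivAt (fun s => (φ s j).τ) (-1) t := hτ' hmem
  have hV := (hasDerivAt_quadForm h.P₁_pos.isHermitian hε).add
    ((hτ'.const_mul δ).exp.mul (hasDerivAt_quadForm h.P₂_pos.isHermitian hθ))
  refine ⟨hV.differentiableAt.hasDerivAt, (hV.deriv.trans ?_).trans_le
    (h.le (Real.exp (δ * (φ t j).τ)) ?_ (φ t j).ε (φ t j).θ (u t j).fst _ ?_ ε'
      (εL_flowMap _ _))⟩
  · simp only [outputErrorL_apply]
    ring
  · have hmem_Icc := hτ (t, j) (hI (Ioo_subset_Icc_self hmem))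
    exact ⟨Real.one_le_exp (mul_nonneg h.δ_pos.le hmem_Icc.1),
      Real.exp_le_exp.2 (mul_le_mul_of_nonneg_left hmem_Icc.2 h.δ_pos.le)⟩
  · rw [State.ε, app, app, app, map_sub]
    exact pl.lipschitz _ _

theorem lyapunov_flow_le (h : IsDissipative pl T₂ lam γ δ P₁ P₂ L H)
    (hs : IsSolutionPair (closedLoop pl T₁ T₂ L H) D φ u) (hτ : ∀ p ∈ D, (φ p.1 p.2).τ ∈ Icc 0 T₂)
    (hab : a ≤ b) (hI : Icc a b ⊆ slice D j) {G : ℝ}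
    (hG : ∀ᵐ t, t ∈ Ioo a b → γ ^ 2 * ‖(u t j).fst‖ ^ 2 ≤ 2 * lam * G) :
    lyapunov pl δ P₁ P₂ (φ b j) ≤
      G + Real.exp (-(2 * lam) * (b - a)) * (lyapunov pl δ P₁ P₂ (φ a j) - G) := by
  have hconst : AbsolutelyContinuousOnInterval (fun _ => G) a b :=
    LipschitzOnWith.absolutelyContinuousOnInterval (K := 0) (LipschitzWith.const _).lipschitzOnWith
  rw [← sub_le_iff_le_add']
  refine le_exp_mul_of_ae_deriv_le_mul
    (v' := fun t => deriv (fun s => lyapunov pl δ P₁ P₂ (φ s j)) t) hab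
    ((isHybridArc_lyapunov hs.arc j a b hab hI).fun_sub hconst) ?_
  filter_upwards [ae_hasDerivAt_lyapunov_and_deriv_le h hs hτ hI, hG] with t ht hGt hmem
  obtain ⟨hderiv, hle⟩ := ht hmem
  refine ⟨hderiv.sub_const G, hle.trans ?_⟩
  linarith [hGt hmem, sq_nonneg ‖app pl.Cp (φ t j).ε‖]

theorem lyapunov_jump (hs : IsSolutionPair (closedLoop pl T₁ T₂ L H) D φ u) {p : ℝ × ℕ}
    (hp : p ∈ jumpTimes D) :
    lyapunov pl δ P₁ P₂ (φ p.1 (p.2 + 1)) = quadForm P₁ (φ p.1 p.2).ε +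
      Real.exp (δ * (φ p.1 (p.2 + 1)).τ) * quadForm P₂ (u p.1 p.2).snd := by
  obtain ⟨-, v, -, hreset⟩ := hs.jump p hp
  set x := φ p.1 p.2
  set η := (u p.1 p.2).snd
  have hθ : outputErrorL pl (φ p.1 (p.2 + 1)) = -η := by
    rw [hreset, outputErrorL_apply, State.mk_ε, State.mk_θ, app, map_sub]
    abel
  rw [lyapunov, hθ, quadForm_neg, hreset, State.mk_ε, State.ε]

theorem lyapunov_jump_le (hP₂ : P₂.PosSemidef) (hδ : 0 ≤ δ)
    (hs : IsSolutionPair (closedLoop pl T₁ T₂ L H) D φ u) {p : ℝ × ℕ} (hp : p ∈ jumpTimes D) :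
    lyapunov pl δ P₁ P₂ (φ p.1 (p.2 + 1)) ≤
      lyapunov pl δ P₁ P₂ (φ p.1 p.2) + Real.exp (δ * T₂) * quadForm P₂ (u p.1 p.2).snd := by
  obtain ⟨-, v, hv, hreset⟩ := hs.jump p hp
  rw [lyapunov_jump hs hp]
  refine add_le_add (le_add_of_nonneg_right
    (mul_nonneg (Real.exp_pos _).le (quadForm_nonneg hP₂ _))) (mul_le_mul_of_nonneg_right ?_
      (quadForm_nonneg hP₂ _))
  rw [hreset, Real.exp_le_exp]
  exact mul_le_mul_of_nonneg_left hv.2 hδ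

theorem exists_lyapunov_le_exp_mul_add (h : IsDissipative pl T₂ lam γ δ P₁ P₂ L H) (hT₁ : 0 < T₁)
    (hT : T₁ ≤ T₂) (hlam : 0 < lam) :
    ∃ C > 0, ∀ D φ u, IsSolutionPair (closedLoop pl T₁ T₂ L H) D φ u → ∀ m : ℝ,
      (∀ j, ∀ᵐ t : ℝ, (t, j) ∈ D → ‖u t j‖ ≤ m) → (∀ p ∈ jumpTimes D, ‖u p.1 p.2‖ ≤ m) →
      ∀ p ∈ D, lyapunov pl δ P₁ P₂ (φ p.1 p.2) ≤
        Real.exp (-(2 * lam) * p.1) * lyapunov pl δ P₁ P₂ (φ 0 0) + C * m ^ 2 := by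
  obtain ⟨q, hq, hP₂⟩ := exists_quadForm_le_mul_norm_sq P₂
  have hr : 0 < Real.exp (2 * lam * T₁) - 1 := sub_pos.2 (Real.one_lt_exp_iff.2 (by positivity))
  refine ⟨γ ^ 2 / (2 * lam) + Real.exp (δ * T₂) * q / (Real.exp (2 * lam * T₁) - 1) *
    Real.exp (2 * lam * T₂), by positivity, fun D φ u hs m hu hη p hp => ?_⟩
  have hτ := isTimer_closedLoop hs hT₁.le hT
  refine (hτ.le_exp_neg_mul_add (c := 2 * lam) (G := γ ^ 2 * m ^ 2 / (2 * lam))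
    (K := Real.exp (δ * T₂) * (q * m ^ 2)) (v := fun t j => lyapunov pl δ P₁ P₂ (φ t j)) hT₁
    (by positivity) (by positivity) (by positivity) (fun j a b hab hI => ?_) (fun p hp => ?_)
    hp).trans_eq (by ring)
  · refine lyapunov_flow_le h hs hτ.mem_Icc hab hI ?_
    filter_upwards [hu j] with t ht hmem
    rw [mul_div_cancel₀ _ (by positivity)]
    gcongr
    exact (WithLp.norm_fst_le _ _).trans (ht (hI (Ioo_subset_Icc_self hmem)))
  · refine (lyapunov_jump_le h.P₂_pos.posSemidef h.δ_pos.le hs hp).trans ?_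
    gcongr
    refine (hP₂ _).trans ?_
    gcongr
    exact (WithLp.norm_snd_le _ _).trans (hη p hp)

/-! ### Stability estimates -/

theorem le_add_of_sq_le_sq_add_sq {x y z : ℝ} (hy : 0 ≤ y) (hz : 0 ≤ z)
    (h : x ^ 2 ≤ y ^ 2 + z ^ 2) : x ≤ y + z :=
  le_of_sq_le_sq (h.trans (by linarith [add_sq y z, mul_nonneg hy hz])) (add_nonneg hy hz)

theorem exists_infDist_target_le_exp_mul_add (h : IsDissipative pl T₂ lam γ δ P₁ P₂ L H)
    (hT₁ : 0 < T₁) (hT : T₁ ≤ T₂) (hlam : 0 < lam) :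
    ∃ κ > 0, ∃ C > 0, ∀ D φ u, IsSolutionPair (closedLoop pl T₁ T₂ L H) D φ u → ∀ m : ℝ, 0 ≤ m →
      (∀ j, ∀ᵐ t : ℝ, (t, j) ∈ D → ‖u t j‖ ≤ m) → (∀ p ∈ jumpTimes D, ‖u p.1 p.2‖ ≤ m) →
      ∀ p ∈ D, Metric.infDist (φ p.1 p.2) (target nz ny T₂) ≤
        κ * Real.exp (-lam * p.1) * Metric.infDist (φ 0 0) (target nz ny T₂) + C * m := by
  obtain ⟨C, hC, hV⟩ := exists_lyapunov_le_exp_mul_add h hT₁ hT hlam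
  obtain ⟨c₁, hc₁, hlower⟩ := exists_mul_infDist_sq_le_lyapunov pl h.P₁_pos h.P₂_pos h.δ_pos.le T₂
  obtain ⟨c₂, hc₂, hupper⟩ := exists_lyapunov_le_mul_infDist_sq pl P₁ P₂ h.δ_pos.le T₂
  refine ⟨√(c₂ / c₁), by positivity, √(C / c₁), by positivity, fun D φ u hs m hm hu hη p hp => ?_⟩
  have hτ := (isTimer_closedLoop hs hT₁.le hT).mem_Icc
  set d := Metric.infDist (φ p.1 p.2) (target nz ny T₂)
  set d₀ := Metric.infDist (φ 0 0) (target nz ny T₂)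
  have hd₀ : 0 ≤ d₀ := Metric.infDist_nonneg
  have hexp : Real.exp (-(2 * lam) * p.1) = Real.exp (-lam * p.1) ^ 2 := by
    rw [← Real.exp_nat_mul]; ring_nf
  refine le_add_of_sq_le_sq_add_sq (by positivity) (by positivity) ?_
  rw [mul_pow, mul_pow, mul_pow, Real.sq_sqrt (by positivity), Real.sq_sqrt (by positivity),
    div_mul_eq_mul_div, div_mul_eq_mul_div, div_mul_eq_mul_div, ← add_div, le_div_iff₀' hc₁, ← hexp]
  calc c₁ * d ^ 2 ≤ lyapunov pl δ P₁ P₂ (φ p.1 p.2) := hlower _ (hτ p hp)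
    _ ≤ Real.exp (-(2 * lam) * p.1) * lyapunov pl δ P₁ P₂ (φ 0 0) + C * m ^ 2 :=
      hV D φ u hs m hu hη p hp
    _ ≤ Real.exp (-(2 * lam) * p.1) * (c₂ * d₀ ^ 2) + C * m ^ 2 := by
      gcongr
      exact hupper _ (hτ _ hs.domain.zero_mem)
    _ = c₂ * Real.exp (-(2 * lam) * p.1) * d₀ ^ 2 + C * m ^ 2 := by ring

theorem isGloballyExpStable_closedLoop (h : IsDissipative pl T₂ lam γ δ P₁ P₂ L H) (hT₁ : 0 < T₁)
    (hT : T₁ ≤ T₂) (hlam : 0 < lam) :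
    IsGloballyExpStable (closedLoop pl T₁ T₂ L H) (target nz ny T₂) lam := by
  refine ⟨(isViable_closedLoop pl L H hT₁.le hT).maximalAreComplete_isZeroInput, ?_⟩
  obtain ⟨κ, hκ, C, -, hbound⟩ := exists_infDist_target_le_exp_mul_add h hT₁ hT hlam
  have hT₂ : 0 ≤ T₂ := hT₁.le.trans hT
  refine ⟨κ * Real.exp (lam * T₂), by positivity, lam * T₁ / (1 + T₁), by positivity,
    fun D φ u hs hzero p hp => ?_⟩
  have hrate : Metric.infDist (φ p.1 p.2) (target nz ny T₂) ≤
      κ * Real.exp (-lam * p.1) * Metric.infDist (φ 0 0) (target nz ny T₂) := by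
    have := hbound D φ u hs 0 le_rfl
      (fun j => Eventually.of_forall fun t ht => by rw [hzero (t, j) ht, norm_zero])
      (fun p hp => by rw [hzero p hp.1, norm_zero]) p hp
    rwa [mul_zero, add_zero] at this
  refine ⟨hrate.trans (mul_le_mul_of_nonneg_right ?_ Metric.infDist_nonneg),
    hrate.trans (mul_le_mul_of_nonneg_right ?_ Metric.infDist_nonneg)⟩
  · rw [mul_assoc]
    gcongr
    exact (isTimer_closedLoop hs hT₁.le hT).exp_neg_mul_le hT₁.le hlam.le hp
  · gcongr
    exact le_mul_of_one_le_right hκ.le (Real.one_le_exp (mul_nonneg hlam.le hT₂))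

theorem exists_infDist_target_le_max (h : IsDissipative pl T₂ lam γ δ P₁ P₂ L H) (hT₁ : 0 < T₁)
    (hT : T₁ ≤ T₂) (hlam : 0 < lam) :
    ∃ κ > 0, ∃ μ > 0, ∃ C > 0, ∀ D φ u, IsSolutionPair (closedLoop pl T₁ T₂ L H) D φ u →
      supNorm D u < ∞ → ∀ p ∈ D, Metric.infDist (φ p.1 p.2) (target nz ny T₂) ≤
        max (κ * Real.exp (-μ * (p.1 + p.2)) * Metric.infDist (φ 0 0) (target nz ny T₂))
          (C * (supNorm D u).toReal) := by
  obtain ⟨κ, hκ, C, hC, hbound⟩ := exists_infDist_target_le_exp_mul_add h hT₁ hT hlam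
  refine ⟨2 * (κ * Real.exp (lam * T₂)), by positivity, lam * T₁ / (1 + T₁), by positivity, 2 * C,
    by positivity, fun D φ u hs hu p hp => ?_⟩
  set d₀ := Metric.infDist (φ 0 0) (target nz ny T₂)
  set r := Real.exp (-(lam * T₁ / (1 + T₁)) * (p.1 + p.2))
  have hd₀ : 0 ≤ d₀ := Metric.infDist_nonneg
  have hexp := (isTimer_closedLoop hs hT₁.le hT).exp_neg_mul_le hT₁.le hlam.le hp
  calc Metric.infDist (φ p.1 p.2) (target nz ny T₂)
      ≤ κ * Real.exp (-lam * p.1) * d₀ + C * (supNorm D u).toReal :=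
        hbound D φ u hs _ ENNReal.toReal_nonneg (hs.domain.ae_norm_le_supNorm hu)
          (fun _ => norm_le_supNorm_of_mem_jumpTimes hu) p hp
    _ ≤ κ * (Real.exp (lam * T₂) * r) * d₀ + C * (supNorm D u).toReal := by gcongr
    _ ≤ 2 * max (κ * (Real.exp (lam * T₂) * r) * d₀) (C * (supNorm D u).toReal) := by
        rw [two_mul]
        exact add_le_add (le_max_left _ _) (le_max_right _ _)
    _ = max (2 * (κ * Real.exp (lam * T₂)) * r * d₀) (2 * C * (supNorm D u).toReal) := by
        rw [mul_max_of_nonneg _ _ zero_le_two]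
        ring_nf

theorem isExpISS_closedLoop (h : IsDissipative pl T₂ lam γ δ P₁ P₂ L H) (hT₁ : 0 < T₁)
    (hT : T₁ ≤ T₂) (hlam : 0 < lam) :
    IsExpISS (closedLoop pl T₁ T₂ L H) (target nz ny T₂) := by
  refine ⟨(isViable_closedLoop pl L H hT₁.le hT).maximalAreComplete_isBoundedOnBounded, ?_⟩
  obtain ⟨κ, hκ, μ, hμ, C, hC, hbound⟩ := exists_infDist_target_le_max h hT₁ hT hlam
  exact ⟨κ, hκ, μ, hμ, fun s => C * s, ⟨by fun_prop,
    fun _ _ _ _ hlt => mul_lt_mul_of_pos_left hlt hC, mul_zero C⟩, hbound⟩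

theorem norm_ε_le_two_mul_infDist_target (hT₂ : 0 ≤ T₂) (x : State nz ny) :
    ‖x.ε‖ ≤ 2 * Metric.infDist x (target nz ny T₂) := by
  refine le_of_sq_le_sq ?_ (mul_nonneg zero_le_two Metric.infDist_nonneg)
  linarith [le_infDist_target_sq hT₂ x, sq_nonneg ‖x.θ‖, sq_nonneg ‖x.ε‖,
    mul_pow 2 (Metric.infDist x (target nz ny T₂)) 2]

theorem exists_norm_ε_le (h : IsDissipative pl T₂ lam γ δ P₁ P₂ L H) (hT₁ : 0 < T₁)
    (hT : T₁ ≤ T₂) (hlam : 0 < lam) (hs : IsSolutionPair (closedLoop pl T₁ T₂ L H) D φ u)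
    (hu : supNorm D u < ∞) : ∃ M : ℝ, ∀ p ∈ D, ‖(φ p.1 p.2).ε‖ ≤ M := by
  obtain ⟨κ, hκ, μ, hμ, C, -, hbound⟩ := exists_infDist_target_le_max h hT₁ hT hlam
  refine ⟨2 * max (κ * Metric.infDist (φ 0 0) (target nz ny T₂)) (C * (supNorm D u).toReal),
    fun p hp => (norm_ε_le_two_mul_infDist_target (hT₁.le.trans hT) _).trans ?_⟩
  refine mul_le_mul_of_nonneg_left ((hbound D φ u hs hu p hp).trans ?_) zero_le_two
  refine max_le_max (mul_le_mul_of_nonneg_right ?_ Metric.infDist_nonneg) le_rfl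
  refine mul_le_of_le_one_right hκ.le (Real.exp_le_one_iff.2 ?_)
  rw [neg_mul, neg_nonpos]
  exact mul_nonneg hμ.le (add_nonneg (hs.domain.nonneg hp) (Nat.cast_nonneg _))

end ClosedLoop

/-! ### The `L₂` gain -/

theorem exists_seq_mem_ae_le {S : Set ℝ} (hS : S.Nonempty) :
    ∃ v : ℕ → ℝ, (∀ n, v n ∈ S) ∧ ∀ᵐ x : ℝ, x ∈ S → ∃ n, x ≤ v n := by
  by_cases hb : BddAbove S
  · obtain ⟨v, -, htendsto, hv⟩ := exists_seq_tendsto_sSup hS hb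
    refine ⟨v, hv, ?_⟩
    filter_upwards [Measure.ae_ne volume (sSup S)] with x hx hxS
    obtain ⟨n, hn⟩ := (htendsto.eventually_const_lt ((le_csSup hb hxS).lt_of_ne hx)).exists
    exact ⟨n, hn.le⟩
  · choose v hv hlt using fun n : ℕ => not_bddAbove_iff.1 hb n
    refine ⟨v, hv, Eventually.of_forall fun x _ => ?_⟩
    obtain ⟨n, hn⟩ := exists_nat_ge x
    exact ⟨n, hn.trans (hlt n).le⟩

theorem setLIntegral_le_of_forall_inter_Iic {S : Set ℝ} {f : ℝ → ℝ≥0∞} {B : ℝ≥0∞}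
    (h : ∀ s ∈ S, ∫⁻ x in S ∩ Iic s, f x ≤ B) : ∫⁻ x in S, f x ≤ B := by
  rcases S.eq_empty_or_nonempty with rfl | hS
  · simp
  obtain ⟨v, hv, hcover⟩ := exists_seq_mem_ae_le hS
  have hdirected : Directed (· ⊆ ·) fun n => S ∩ Iic (v n) :=
    (Std.Total.directed (r := (· ≤ ·)) v).mono_comp (rb := (· ⊆ ·)) (g := fun r => S ∩ Iic r) _
      fun _ _ hle => inter_subset_inter_right S (Iic_subset_Iic.2 hle)
  calc ∫⁻ x in S, f x ≤ ∫⁻ x in ⋃ n, S ∩ Iic (v n), f x := by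
        refine lintegral_mono' (Measure.restrict_mono_ae ?_) le_rfl
        filter_upwards [hcover] with x hx hxS
        obtain ⟨n, hn⟩ := hx hxS
        exact mem_iUnion.2 ⟨n, hxS, hn⟩
    _ = ⨆ n, ∫⁻ x in S ∩ Iic (v n), f x := setLIntegral_iUnion_of_directed f hdirected
    _ ≤ B := iSup_le fun n => h _ (hv n)

theorem ofReal_integral_norm_sq {α F : Type*} [MeasurableSpace α] [NormedAddCommGroup F]
    {μ : Measure α} {f : α → F} (hf : Integrable (fun x => ‖f x‖ ^ 2) μ) :
    ENNReal.ofReal (∫ x, ‖f x‖ ^ 2 ∂μ) = ∫⁻ x, ‖f x‖ₑ ^ 2 ∂μ := by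
  rw [ofReal_integral_eq_lintegral_ofReal hf (Eventually.of_forall fun _ => sq_nonneg _)]
  simp only [ENNReal.ofReal_pow (norm_nonneg _), ofReal_norm]

theorem ofReal_sq_rpow_half {r : ℝ} (hr : 0 ≤ r) :
    ENNReal.ofReal (r ^ 2) ^ (1 / 2 : ℝ) = ENNReal.ofReal r := by
  rw [ENNReal.ofReal_rpow_of_nonneg (sq_nonneg r) (by norm_num), ← Real.sqrt_eq_rpow,
    Real.sqrt_sq hr]

theorem rpow_half_le_ofReal_add_mul {a b : ℝ≥0∞} {r s : ℝ} (hr : 0 ≤ r) (hs : 0 ≤ s)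
    (h : a ≤ ENNReal.ofReal (r ^ 2) + ENNReal.ofReal (s ^ 2) * b) :
    a ^ (1 / 2 : ℝ) ≤ ENNReal.ofReal r + ENNReal.ofReal s * b ^ (1 / 2 : ℝ) := by
  calc a ^ (1 / 2 : ℝ)
      ≤ (ENNReal.ofReal (r ^ 2) + ENNReal.ofReal (s ^ 2) * b) ^ (1 / 2 : ℝ) :=
        ENNReal.rpow_le_rpow h (by norm_num)
    _ ≤ ENNReal.ofReal (r ^ 2) ^ (1 / 2 : ℝ) + (ENNReal.ofReal (s ^ 2) * b) ^ (1 / 2 : ℝ) :=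
        ENNReal.rpow_add_le_add_rpow _ _ (by norm_num) (by norm_num)
    _ = ENNReal.ofReal r + ENNReal.ofReal s * b ^ (1 / 2 : ℝ) := by
        rw [ENNReal.mul_rpow_of_nonneg _ _ (by norm_num), ofReal_sq_rpow_half hr,
          ofReal_sq_rpow_half hs]

section HybridSignals

variable {U : Type*} [NormedAddCommGroup U] {D : Set (ℝ × ℕ)} {j : ℕ} {a b : ℝ}

theorem IsHybridArc.integrableOn_norm_sq {φ : ℝ → ℕ → U} (hφ : IsHybridArc D φ) (hab : a ≤ b)
    (hI : Icc a b ⊆ slice D j) : IntegrableOn (fun t => ‖φ t j‖ ^ 2) (Ioc a b) := by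
  have hcont := (hφ j a b hab hI).continuousOn
  rw [uIcc_of_le hab] at hcont
  exact (hcont.norm.pow 2).integrableOn_Icc.mono_set Ioc_subset_Icc_self

theorem IsHybridInput.integrableOn_norm_fst_sq {V : Type*} [NormedAddCommGroup V]
    {u : ℝ → ℕ → WithLp 2 (U × V)} (hu : IsHybridInput D u) (hI : Icc a b ⊆ slice D j) :
    IntegrableOn (fun t => ‖(u t j).fst‖ ^ 2) (Ioc a b) := by
  obtain ⟨hmeas, hbdd⟩ := hu j
  obtain ⟨M, hM⟩ := hbdd a b hI
  have hmeas' : AEStronglyMeasurable (fun t => (u t j).fst) (volume.restrict (Ioc a b)) :=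
    (continuous_fst.comp (WithLp.prod_continuous_ofLp 2 U V)).comp_aestronglyMeasurable
      (hmeas.mono_measure (Measure.restrict_mono (Ioc_subset_Icc_self.trans hI) le_rfl))
  refine Integrable.of_bound (hmeas'.norm.pow 2) (M ^ 2) ?_
  filter_upwards [ae_restrict_of_ae_restrict_of_subset Ioc_subset_Icc_self hM] with t ht
  rw [Real.norm_of_nonneg (sq_nonneg _)]
  exact pow_le_pow_left₀ (norm_nonneg _) ((WithLp.norm_fst_le _ _).trans ht) 2

theorem IsHybridTimeDomain.lintegral_inter_Iic (hD : IsHybridTimeDomain D) (hab : a ≤ b)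
    (hI : Icc a b ⊆ slice D j) (g : ℝ → ℕ → ℝ≥0∞) :
    ∫⁻ s in ordinaryTimes D ∩ Iic b, g s (firstIndex D s) =
      (∫⁻ s in ordinaryTimes D ∩ Iic a, g s (firstIndex D s)) + ∫⁻ s in Ioc a b, g s j := by
  have hunion : ordinaryTimes D ∩ Iic b = ordinaryTimes D ∩ Iic a ∪ Ioc a b := by
    rw [← Iic_union_Ioc_eq_Iic hab, inter_union_distrib_left,
      inter_eq_right.2 (Ioc_subset_ordinaryTimes hI)]
  rw [hunion, lintegral_union measurableSet_Ioc
    ((Iic_disjoint_Ioc le_rfl).mono_left inter_subset_right)]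
  congr 1
  exact setLIntegral_congr_fun measurableSet_Ioc fun s hs => by rw [hD.firstIndex_eq hI hs]

theorem IsHybridTimeDomain.volume_ordinaryTimes_inter_Iic_zero (hD : IsHybridTimeDomain D) :
    volume (ordinaryTimes D ∩ Iic 0) = 0 := by
  refine measure_mono_null (t := {0}) ?_ Real.volume_singleton
  rintro s ⟨⟨j, hj⟩, hs⟩
  exact le_antisymm hs (hD.nonneg hj)

end HybridSignals

section Gain

variable {nz ny nw nq ns np : ℕ} {pl : Plant nz ny nw nq ns np} {T₁ T₂ lam γ δ : ℝ}
  {P₁ : Matrix (Fin nz) (Fin nz) ℝ} {P₂ : Matrix (Fin ny) (Fin ny) ℝ}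
  {L : Matrix (Fin nz) (Fin ny) ℝ} {H : Matrix (Fin ny) (Fin ny) ℝ} {D : Set (ℝ × ℕ)}
  {φ : ℝ → ℕ → State nz ny} {u : ℝ → ℕ → WithLp 2 (E nw × E ny)} {j : ℕ} {a b : ℝ}

theorem lyapunov_add_integral_flow_le (h : IsDissipative pl T₂ lam γ δ P₁ P₂ L H) (hlam : 0 ≤ lam)
    (hs : IsSolutionPair (closedLoop pl T₁ T₂ L H) D φ u)
    (hτ : ∀ p ∈ D, (φ p.1 p.2).τ ∈ Icc 0 T₂) (hab : a ≤ b) (hI : Icc a b ⊆ slice D j) :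
    lyapunov pl δ P₁ P₂ (φ b j) + ∫ t in Ioc a b, ‖app pl.Cp (φ t j).ε‖ ^ 2 ≤
      lyapunov pl δ P₁ P₂ (φ a j) + γ ^ 2 * ∫ t in Ioc a b, ‖(u t j).fst‖ ^ 2 := by
  have hy : IntegrableOn (fun t => ‖app pl.Cp (φ t j).ε‖ ^ 2) (Ioc a b) :=
    (hs.arc.clm_comp ((appL pl.Cp).comp State.εL)).integrableOn_norm_sq hab hI
  have hw := (hs.input.integrableOn_norm_fst_sq hI).const_mul (γ ^ 2)
  have hsupply : IntegrableOn
      (fun t => γ ^ 2 * ‖(u t j).fst‖ ^ 2 - ‖app pl.Cp (φ t j).ε‖ ^ 2) (Ioc a b) := hw.sub hy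
  have hderiv : ∀ᵐ t, t ∈ Ioo a b → HasDerivAt (fun s => lyapunov pl δ P₁ P₂ (φ s j))
      (deriv (fun s => lyapunov pl δ P₁ P₂ (φ s j)) t) t ∧
      deriv (fun s => lyapunov pl δ P₁ P₂ (φ s j)) t ≤
        γ ^ 2 * ‖(u t j).fst‖ ^ 2 - ‖app pl.Cp (φ t j).ε‖ ^ 2 := by
    filter_upwards [ae_hasDerivAt_lyapunov_and_deriv_le h hs hτ hI] with t ht hmem
    refine ⟨(ht hmem).1, (ht hmem).2.trans ?_⟩
    linarith [mul_nonneg hlam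
      (lyapunov_nonneg (pl := pl) (δ := δ) h.P₁_pos.posSemidef h.P₂_pos.posSemidef (φ t j))]
  have hV := sub_le_integral_of_ae_hasDerivAt hab (isHybridArc_lyapunov hs.arc j a b hab hI)
    hderiv hsupply
  rw [integral_sub hw hy, integral_const_mul] at hV
  linarith

theorem lyapunov_add_lintegral_flow_le (h : IsDissipative pl T₂ lam γ δ P₁ P₂ L H) (hlam : 0 ≤ lam)
    (hs : IsSolutionPair (closedLoop pl T₁ T₂ L H) D φ u)
    (hτ : ∀ p ∈ D, (φ p.1 p.2).τ ∈ Icc 0 T₂) (hab : a ≤ b) (hI : Icc a b ⊆ slice D j) :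
    ENNReal.ofReal (lyapunov pl δ P₁ P₂ (φ b j)) +
        ∫⁻ t in Ioc a b, ‖app pl.Cp (φ t j).ε‖ₑ ^ 2 ≤
      ENNReal.ofReal (lyapunov pl δ P₁ P₂ (φ a j)) +
        ENNReal.ofReal (γ ^ 2) * ∫⁻ t in Ioc a b, ‖(u t j).fst‖ₑ ^ 2 := by
  have hV := lyapunov_nonneg (pl := pl) (δ := δ) h.P₁_pos.posSemidef h.P₂_pos.posSemidef
  have hy : IntegrableOn (fun t => ‖app pl.Cp (φ t j).ε‖ ^ 2) (Ioc a b) :=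
    (hs.arc.clm_comp ((appL pl.Cp).comp State.εL)).integrableOn_norm_sq hab hI
  rw [← ofReal_integral_norm_sq hy,
    ← ofReal_integral_norm_sq (hs.input.integrableOn_norm_fst_sq hI),
    ← ENNReal.ofReal_mul (sq_nonneg γ), ← ENNReal.ofReal_add (hV _) (by positivity),
    ← ENNReal.ofReal_add (hV _) (by positivity)]
  exact ENNReal.ofReal_le_ofReal (lyapunov_add_integral_flow_le h hlam hs hτ hab hI)

theorem lyapunov_add_lintegral_le (h : IsDissipative pl T₂ lam γ δ P₁ P₂ L H) (hlam : 0 ≤ lam)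
    (hs : IsSolutionPair (closedLoop pl T₁ T₂ L H) D φ u)
    (hτ : ∀ p ∈ D, (φ p.1 p.2).τ ∈ Icc 0 T₂) (hη : IsZeroInput D fun t j => (u t j).snd) :
    ∀ p ∈ D, ENNReal.ofReal (lyapunov pl δ P₁ P₂ (φ p.1 p.2)) +
        ∫⁻ s in ordinaryTimes D ∩ Iic p.1, ‖app pl.Cp (φ s (firstIndex D s)).ε‖ₑ ^ 2 ≤
      ENNReal.ofReal (lyapunov pl δ P₁ P₂ (φ 0 0)) + ENNReal.ofReal (γ ^ 2) *
        ∫⁻ s in ordinaryTimes D ∩ Iic p.1, ‖(u s (firstIndex D s)).fst‖ₑ ^ 2 := by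
  refine hs.domain.induction (Q := fun t j => ENNReal.ofReal (lyapunov pl δ P₁ P₂ (φ t j)) +
      ∫⁻ s in ordinaryTimes D ∩ Iic t, ‖app pl.Cp (φ s (firstIndex D s)).ε‖ₑ ^ 2 ≤
    ENNReal.ofReal (lyapunov pl δ P₁ P₂ (φ 0 0)) + ENNReal.ofReal (γ ^ 2) *
      ∫⁻ s in ordinaryTimes D ∩ Iic t, ‖(u s (firstIndex D s)).fst‖ₑ ^ 2)
    ?_ (fun j a b hab hI ih => ?_) fun p hp ih => ?_
  · have h0 := hs.domain.volume_ordinaryTimes_inter_Iic_zero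
    simp only [setLIntegral_measure_zero _ _ h0, mul_zero, add_zero, le_refl]
  · rw [hs.domain.lintegral_inter_Iic hab hI (fun s j => ‖app pl.Cp (φ s j).ε‖ₑ ^ 2),
      hs.domain.lintegral_inter_Iic hab hI (fun s j => ‖(u s j).fst‖ₑ ^ 2), mul_add]
    calc _ = (ENNReal.ofReal (lyapunov pl δ P₁ P₂ (φ b j)) +
            ∫⁻ t in Ioc a b, ‖app pl.Cp (φ t j).ε‖ₑ ^ 2) +
            ∫⁻ s in ordinaryTimes D ∩ Iic a, ‖app pl.Cp (φ s (firstIndex D s)).ε‖ₑ ^ 2 := by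
          ring
      _ ≤ _ := add_le_add_left (lyapunov_add_lintegral_flow_le h hlam hs hτ hab hI) _
      _ = (ENNReal.ofReal (lyapunov pl δ P₁ P₂ (φ a j)) +
            ∫⁻ s in ordinaryTimes D ∩ Iic a, ‖app pl.Cp (φ s (firstIndex D s)).ε‖ₑ ^ 2) +
            ENNReal.ofReal (γ ^ 2) * ∫⁻ t in Ioc a b, ‖(u t j).fst‖ₑ ^ 2 := by ring
      _ ≤ _ := add_le_add_left ih _
      _ = _ := by ring
  · refine le_trans (add_le_add_left (ENNReal.ofReal_le_ofReal ?_) _) ih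
    have hjump := lyapunov_jump_le (P₁ := P₁) h.P₂_pos.posSemidef h.δ_pos.le hs hp
    rwa [show (u p.1 p.2).snd = 0 from hη p hp.1, quadForm, inner_zero_left, mul_zero,
      add_zero] at hjump

theorem exists_l2Norm_le (h : IsDissipative pl T₂ lam γ δ P₁ P₂ L H) (hT₁ : 0 ≤ T₁)
    (hT : T₁ ≤ T₂) (hlam : 0 ≤ lam) (hγ : 0 ≤ γ) :
    ∃ α > 0, ∀ D φ u, IsSolutionPair (closedLoop pl T₁ T₂ L H) D φ u →
      IsZeroInput D (fun t j => (u t j).snd) →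
      l2Norm D (fun t j => app pl.Cp (φ t j).ε) ≤
        ENNReal.ofReal (α * Metric.infDist (φ 0 0) (target nz ny T₂)) +
          ENNReal.ofReal γ * l2Norm D (fun t j => (u t j).fst) := by
  obtain ⟨c, hc, hupper⟩ := exists_lyapunov_le_mul_infDist_sq pl P₁ P₂ h.δ_pos.le T₂
  refine ⟨√c, Real.sqrt_pos.2 hc, fun D φ u hs hη => ?_⟩
  have hτ := (isTimer_closedLoop hs hT₁ hT).mem_Icc
  refine rpow_half_le_ofReal_add_mul (mul_nonneg (Real.sqrt_nonneg c) Metric.infDist_nonneg) hγ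
    (setLIntegral_le_of_forall_inter_Iic ?_)
  rintro s ⟨j, hj⟩
  refine (le_add_self.trans (lyapunov_add_lintegral_le h hlam hs hτ hη (s, j) hj)).trans ?_
  gcongr
  · rw [mul_pow, Real.sq_sqrt hc.le]
    exact hupper _ (hτ _ hs.domain.zero_mem)
  · exact inter_subset_left

end Gain

theorem IsDissipative.solvesEstimationProblem {nz ny nw nq ns np : ℕ}
    {pl : Plant nz ny nw nq ns np} {T₁ T₂ lam γ δ : ℝ} {P₁ : Matrix (Fin nz) (Fin nz) ℝ}
    {P₂ : Matrix (Fin ny) (Fin ny) ℝ} {L : Matrix (Fin nz) (Fin ny) ℝ}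
    {H : Matrix (Fin ny) (Fin ny) ℝ} (h : IsDissipative pl T₂ lam γ δ P₁ P₂ L H) (hT₁ : 0 < T₁)
    (hT : T₁ ≤ T₂) (hlam : 0 < lam) (hγ : 0 ≤ γ) : SolvesEstimationProblem pl T₁ T₂ lam γ L H where
  exp_stable := isGloballyExpStable_closedLoop h hT₁ hT hlam
  exp_iss := isExpISS_closedLoop h hT₁ hT hlam
  error_bounded _ _ _ hs hu := exists_norm_ε_le h hT₁ hT hlam hs hu
  l2_stable := exists_l2Norm_le h hT₁.le hT hlam.le hγ

/-! ### A feasible instance with `δ < 2 λ` -/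

section Example

open Matrix

/-- The scalar plant `ż = -z + ψ(z / 2) / 2 + w`, `y = z + η`, `y_p = z - ẑ`, with `ψ` the
identity; it witnesses feasibility of the matrix inequalities with `δ < 2 λ`. -/
def scalarPlant : Plant 1 1 1 1 1 1 where
  A := -1
  B := (1 / 2 : ℝ) • 1
  C := 1
  N := 1
  S := (1 / 2 : ℝ) • 1
  Cp := 1
  ψ := id
  ℓ := 1
  ℓ_pos := one_pos
  lipschitz _ _ := (one_mul _).ge

theorem isHermitian_lmiMatrix {nz ny nw nq ns np : ℕ} (pl : Plant nz ny nw nq ns np)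
    (lam γ δ χ e : ℝ) {P₁ : Matrix (Fin nz) (Fin nz) ℝ} {P₂ : Matrix (Fin ny) (Fin ny) ℝ}
    (hP₁ : P₁.IsHermitian) (hP₂ : P₂.IsHermitian)
    (X : Matrix (Fin nz) (Fin nz) ℝ) (U W : Matrix (Fin ny) (Fin ny) ℝ)
    (J : Matrix (Fin nz) (Fin ny) ℝ) :
    (lmiMatrix pl lam γ δ χ e P₁ P₂ X U W J).IsHermitian := by
  rw [IsHermitian, conjTranspose_eq_transpose_of_trivial] at *
  simp [lmiMatrix, He, fromBlocks_transpose, hP₁, hP₂, add_comm]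

theorem posDef_smul_one {n : ℕ} {r : ℝ} (hr : 0 < r) :
    (r • (1 : Matrix (Fin n) (Fin n) ℝ)).PosDef :=
  PosDef.one.smul hr

theorem exists_eq_lmiVec {nz ny nw ns : ℕ}
    (v : ((Fin nz ⊕ Fin ny) ⊕ (Fin nz ⊕ Fin ny)) ⊕ (Fin nw ⊕ Fin ns) → ℝ) :
    ∃ a b c d w ζ, v = lmiVec a b c d w ζ :=
  ⟨fun i => v (.inl (.inl (.inl i))), fun i => v (.inl (.inl (.inr i))),
    fun i => v (.inl (.inr (.inl i))), fun i => v (.inl (.inr (.inr i))),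
    fun i => v (.inr (.inl i)), fun i => v (.inr (.inr i)),
    by ext ((((i | i) | (i | i))) | (i | i)) <;> rfl⟩

theorem lmiVec_dotProduct_self {nz ny nw ns : ℕ} (a c : Fin nz → ℝ) (b d : Fin ny → ℝ)
    (w : Fin nw → ℝ) (ζ : Fin ns → ℝ) :
    lmiVec a b c d w ζ ⬝ᵥ lmiVec a b c d w ζ =
      a ⬝ᵥ a + b ⬝ᵥ b + (c ⬝ᵥ c + d ⬝ᵥ d) + (w ⬝ᵥ w + ζ ⬝ᵥ ζ) := by
  simp only [lmiVec, sumElim_dotProduct_sumElim]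

/-- The left-hand side is the quadratic form of the matrix of `negDef_lmiMatrix_scalarPlant`. The
squares are those of the `LDLᵀ` factorization of the difference of the two sides, with the variables
eliminated in the order `w, ζ, a, b, c, d`. -/
theorem scalarPlant_form_le {e : ℝ} (he : e = 1 ∨ e = 11 / 10) (a b c d w ζ : ℝ) :
    10 * a * c + 8 * e * b * d + 8 * c ^ 2 + 2 * e * d ^ 2 - 25 * w ^ 2 - 8 * ζ ^ 2
      + 2 * (13 * (-c + ζ / 2 + w - a) * (a + c) + 3 * (a + c) * (d - c))
      + 2 * (11 / 2 * (a - b) * (b + d) - 5 * (b + d) * (d - c)) ≤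
      -(1 / 4) * (a * a + b * b + (c * c + d * d) + (w * w + ζ * ζ)) := by
  rcases he with rfl | rfl
  · linarith [sq_nonneg (w - 52 / 99 * a - 52 / 99 * c),
      sq_nonneg (ζ - 26 / 31 * a - 26 / 31 * c),
      sq_nonneg (a - 67518 / 165359 * b + 143876 / 165359 * c - 6138 / 9727 * d),
      sq_nonneg (b - 141908 / 5625041 * c + 2003722 / 5625041 * d),
      sq_nonneg (c - 11877232 / 28512931 * d), sq_nonneg d]
  · linarith [sq_nonneg (w - 52 / 99 * a - 52 / 99 * c),
      sq_nonneg (ζ - 26 / 31 * a - 26 / 31 * c),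
      sq_nonneg (a - 67518 / 165359 * b + 143876 / 165359 * c - 6138 / 9727 * d),
      sq_nonneg (b - 141908 / 5625041 * c + 8695738 / 28125205 * d),
      sq_nonneg (c - 60521424 / 142564655 * d), sq_nonneg d]

theorem negDef_lmiMatrix_scalarPlant {e : ℝ} (he : e = 1 ∨ e = 11 / 10) :
    NegDef (lmiMatrix scalarPlant (1 / 2) 5 (1 / 2) 8 e ((5 : ℝ) • 1) ((4 : ℝ) • 1)
      ((13 : ℝ) • 1) ((11 / 2 : ℝ) • 1) ((-5 : ℝ) • 1) ((3 : ℝ) • 1)) := by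
  rw [NegDef, posDef_iff_dotProduct_mulVec]
  refine ⟨(isHermitian_lmiMatrix _ _ _ _ _ _ (posDef_smul_one (by norm_num)).isHermitian
    (posDef_smul_one (by norm_num)).isHermitian _ _ _ _).neg, fun v hv => ?_⟩
  have hpos : 0 < v ⬝ᵥ v := dotProduct_star_self_pos_iff.2 hv
  obtain ⟨a, b, c, d, w, ζ, rfl⟩ := exists_eq_lmiVec v
  rw [lmiVec_dotProduct_self] at hpos
  rw [star_trivial, neg_mulVec, dotProduct_neg, lmiVec_dotProduct_lmiMatrix_mulVec]
  have hle := scalarPlant_form_le he (a 0) (b 0) (c 0) (d 0) (w 0) (ζ 0)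
  simp only [scalarPlant, dotProduct, mulVec, Fin.sum_univ_one, Matrix.smul_apply,
    Matrix.neg_apply, one_apply_eq, smul_eq_mul, Pi.add_apply, Pi.sub_apply] at hpos ⊢
  linarith

theorem lmisFeasibleAt_scalarPlant :
    LMIsFeasibleAt scalarPlant (2 * Real.log (11 / 10)) (1 / 2) 5 (1 / 2) 8 ((5 : ℝ) • 1)
      ((4 : ℝ) • 1) ((13 : ℝ) • 1) ((11 / 2 : ℝ) • 1) ((-5 : ℝ) • 1) ((3 : ℝ) • 1) where
  P₁_pos := posDef_smul_one (by norm_num)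
  P₂_pos := posDef_smul_one (by norm_num)
  δ_pos := by norm_num
  χ_pos := by norm_num
  lmi_zero := negDef_lmiMatrix_scalarPlant (Or.inl rfl)
  lmi_T₂ := negDef_lmiMatrix_scalarPlant (Or.inr (by
    rw [← mul_assoc, div_mul_cancel₀ _ two_ne_zero, one_mul, Real.exp_log (by norm_num)]))

end Example

end SporadicObserver

end

open SporadicObserver in
theorem proposition4 :
    (∀ {nz ny nw nq ns np : ℕ} (pl : Plant nz ny nw nq ns np) (T₁ T₂ lam γ : ℝ),
      0 < T₁ → T₁ ≤ T₂ → 0 < lam → 0 < γ →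
      ∀ (δ χ : ℝ) (P₁ : Matrix (Fin nz) (Fin nz) ℝ) (P₂ : Matrix (Fin ny) (Fin ny) ℝ)
        (X : Matrix (Fin nz) (Fin nz) ℝ) (U W : Matrix (Fin ny) (Fin ny) ℝ)
        (J : Matrix (Fin nz) (Fin ny) ℝ),
        LMIsFeasibleAt pl T₂ lam γ δ χ P₁ P₂ X U W J →
        IsUnit X.det ∧ IsUnit U.det ∧
          SolvesEstimationProblem pl T₁ T₂ lam γ ((Xᵀ)⁻¹ * J) ((Uᵀ)⁻¹ * W)) ∧
    (∃ (nz ny nw nq ns np : ℕ) (pl : Plant nz ny nw nq ns np) (T₂ lam γ δ χ : ℝ)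
        (P₁ : Matrix (Fin nz) (Fin nz) ℝ) (P₂ : Matrix (Fin ny) (Fin ny) ℝ)
        (X : Matrix (Fin nz) (Fin nz) ℝ) (U W : Matrix (Fin ny) (Fin ny) ℝ)
        (J : Matrix (Fin nz) (Fin ny) ℝ),
        0 < nz ∧ 0 < ny ∧ 0 < T₂ ∧ 0 < lam ∧ 0 < γ ∧ δ < 2 * lam ∧
        LMIsFeasibleAt pl T₂ lam γ δ χ P₁ P₂ X U W J) := by
  refine ⟨?_, 1, 1, 1, 1, 1, 1, scalarPlant, _, _, _, _, _, _, _, _, _, _, _, one_pos, one_pos,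
    mul_pos two_pos (Real.log_pos (by norm_num)), by norm_num, by norm_num, by norm_num,
    lmisFeasibleAt_scalarPlant⟩
  intro nz ny nw nq ns np pl T₁ T₂ lam γ hT₁ hT hlam hγ δ χ P₁ P₂ X U W J h
  exact ⟨h.isUnit_det_X, h.isUnit_det_U,
    h.isDissipative.solvesEstimationProblem hT₁ hT hlam hγ.le⟩
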